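/- Let $d\ge 2$, $\hat g(\xi)=\int_{\mathbb R^d} g(x)e^{-2\pi i x\cdot\xi}\,dx$, and $\tilde g(x)=\overline{g(-x)}$. *Classical spaces.* Let $\Phi,\varphi\in\mathcal S(\mathbb R^d)$ satisfy $\operatorname{supp}\hat\varphi\subseteq\{\tfrac12\le|\xi|\le2\}$, $\operatorname{supp}\hat\Phi\subseteq\{|\xi|\le2\}$, and, for some $c_0>0$, $|\hat\varphi(\xi)|\ge c_0$ for $\tfrac35\le|\xi|\le\tfrac53$ and $|\hat\Phi(\xi)|\ge c_0$ for $|\xi|\le\tfrac53$. Put $\varphi_{2^\nu I}(x)=2^{d\nu}\varphi(2^\nu x)$ and $\varphi_{\nu,0}(x)=2^{d\nu/2}\varphi(2^\nu x)$ for $\nu\in\mathbb N_0$. For $\alpha\in\mathbb R$, $0<p<\infty$, $0<q\le\infty$ and $f\in\mathcal S'(\mathbb R^d)$ let $$\|f\|_{F^{\alpha,q}_p}=\|\Phi*f\|_{L^p}+\Big\|\Big(\sum_{\nu\ge0}\big(2^{\nu\alpha}|\varphi_{2^\nu I}*f|\big)^q\Big)^{1/q}\Big\|_{L^p}$$ (a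 supremum over $\nu$ if $q=\infty$). *Shear anisotropic spaces.* Let $\hat\psi_1,\hat\psi_2\in C^\infty(\mathbb R)$ be complex valued, $\operatorname{supp}\hat\psi_1\subset[-\frac12,-\frac1{16}]\cup[\frac1{16},\frac12]$, $\operatorname{supp}\hat\psi_2\subset[-1,1]$, $\sum_{j\ge0}|\hat\psi_1(2^{-2j}\omega)|^2=1$ for $|\omega|\ge\frac18$, and $|\hat\psi_2(\omega-1)|^2+|\hat\psi_2(\omega)|^2+|\hat\psi_2(\omega+1)|^2=1$ for $|\omega|\le1$. For $i=1,\dots,d$ let $\psi^{(i)}\in\mathcal S(\mathbb R^d)$ be given by $\widehat{\psi^{(i)}}(\xi)=\hat\psi_1(\xi_i)\prod_{m\ne i}\hat\psi_2(\xi_m/\xi_i)$. Let $\Psi\in\mathcal S(\mathbb R^d)$ with $\operatorname{supp}\hat\Psi\subseteq[-\frac14,\frac14]^d$ and $|\hat\Psi|=1$ on $[-\frac18,\frac18]^d$. Let $A_{(i)}$ be the diagonal matrix with $i$-th diagonal entry $4$ and all others $2$. For $\ell=(\ell_m)_{m\ne i}\in\mathbb Z^{d-1}$ let $B_{(i)}^{[\ell]}$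 be the identity matrix with, in addition, the entries $\ell_m$ in the places $(i,m)$, $m\ne i$. For an invertible matrix $M$ put $g_M(x)=|\det M|^{-1}g(M^{-1}x)$, let $|Q_j|=2^{-(d+1)j}$, and write $|[\ell]|\preceq2^j$ if $|\ell_m|\le2^j$ for all $m$. For $\alpha,p,q,f$ as above let $$\|f\|_{F^{\alpha,q}_p(AB)}=\|f*\Psi\|_{L^p}+\Big\|\Big(\sum_{i=1}^d\sum_{j\ge0}\sum_{|[\ell]|\preceq2^j}\big(|Q_j|^{-\alpha}\,\big|\tilde\psi^{(i)}_{A_{(i)}^{-j}B_{(i)}^{[-\ell]}}*f\big|\big)^q\Big)^{1/q}\Big\|_{L^p}$$ (a supremum if $q=\infty$). **Theorem.** Let $\alpha_1,\alpha_2\in\mathbb R$, $0<q_1,q_2\le\infty$ and $0<p_1,p_2<\infty$ satisfy $$\frac{d-1}{q_2}+(d+1)\alpha_2+\frac{2d}{p_1}<2\alpha_1+\frac{d}{p_2}\qquad\Big(\text{with }\tfrac1\infty=0\Big).$$ Then there are functions $f^{(\nu)}$, $\nu\in\mathbb N_0$, each a scalar multiple of the dyadic wavelet $\varphi_{\nu,0}$,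 and constants $0<c\le C<\infty$ independent of $\nu$, such that $$c\le\|f^{(\nu)}\|_{F^{\alpha_1,q_1}_{p_1}}\le C\quad\text{for all }\nu\ge0,$$ while $\|f^{(\nu)}\|_{F^{\alpha_2,q_2}_{p_2}(AB)}<\infty$ for all $\nu\ge0$ and $\|f^{(\nu)}\|_{F^{\alpha_2,q_2}_{p_2}(AB)}\to0$ as $\nu\to\infty$. -/

import Mathlib

open MeasureTheory Filter Topology
open scoped ENNReal NNReal SchwartzMap FourierTransform

namespace ShearTL

/-- Euclidean space `ℝ^d`. -/
abbrev E (d : ℕ) : Type := EuclideanSpace ℝ (Fin d)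

/-! ### Reflection, dilations and convolution -/

/-- The invertible linear map of `ℝ^d` given by an invertible matrix. -/
noncomputable def euclEquiv {d : ℕ} (M : GL (Fin d) ℝ) : E d ≃L[ℝ] E d :=
  ContinuousLinearEquiv.unitsEquiv ℝ (E d)
    (Units.map ((Matrix.toEuclideanCLM (𝕜 := ℝ) (n := Fin d)) :
      Matrix (Fin d) (Fin d) ℝ →* (E d →L[ℝ] E d)) M)

/-- The reflection `x ↦ g (-x)`. -/
noncomputable def reflect {d : ℕ} (g : 𝓢(E d, ℂ)) : 𝓢(E d, ℂ) :=
  SchwartzMap.compCLMOfContinuousLinearEquiv ℂ (ContinuousLinearEquiv.neg ℝ : E d ≃L[ℝ] E d) g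

/-- The function `g~ (x) = conj (g (-x))`. -/
noncomputable def tilde {d : ℕ} (g : 𝓢(E d, ℂ)) : 𝓢(E d, ℂ) :=
  SchwartzMap.postcompCLM (𝕜 := ℝ) (Complex.conjCLE : ℂ →L[ℝ] ℂ) (reflect g)

/-- The anisotropic dilation `g_M (x) = |det M|⁻¹ g (M⁻¹ x)` of `g` by an invertible matrix. -/
noncomputable def dilate {d : ℕ} (M : GL (Fin d) ℝ) (g : 𝓢(E d, ℂ)) : 𝓢(E d, ℂ) :=
  ((|(M : Matrix (Fin d) (Fin d) ℝ).det|⁻¹ : ℝ) : ℂ) •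
    SchwartzMap.compCLMOfContinuousLinearEquiv ℂ (euclEquiv M⁻¹) g

/-- The function `x ↦ g (2^ν x)`. -/
noncomputable def compDyadic {d : ℕ} (ν : ℕ) (g : 𝓢(E d, ℂ)) : 𝓢(E d, ℂ) :=
  SchwartzMap.compCLMOfContinuousLinearEquiv ℂ
    (ContinuousLinearEquiv.smulLeft (R₁ := ℝ) (M₁ := E d)
      (Units.mk0 ((2 : ℝ) ^ ν) (pow_ne_zero ν two_ne_zero))) g

/-- The `L¹`-normalized dyadic dilation `x ↦ 2^{dν} φ(2^ν x)`. -/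
noncomputable def dyadicDilate {d : ℕ} (ν : ℕ) (g : 𝓢(E d, ℂ)) : 𝓢(E d, ℂ) :=
  ((2 : ℂ) ^ (d * ν)) • compDyadic ν g

/-- The `L²`-normalized dyadic wavelet `φ_{ν,0} (x) = 2^{dν/2} φ(2^ν x)` attached to the
dyadic cube `[0, 2^{-ν}]^d`. -/
noncomputable def dyadicWavelet {d : ℕ} (φ : 𝓢(E d, ℂ)) (ν : ℕ) : 𝓢(E d, ℂ) :=
  (((2 : ℝ) ^ ((d : ℝ) * (ν : ℝ) / 2) : ℝ) : ℂ) • compDyadic ν φ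

/-- The convolution of a tempered distribution `f` with a Schwartz function `g`, as the function
`x ↦ f (g (x - ·))`. -/
noncomputable def conv {d : ℕ} (f : 𝓢'(E d, ℂ)) (g : 𝓢(E d, ℂ)) (x : E d) : ℂ :=
  f ((reflect g).compSubConstCLM ℂ x)

/-! ### Mixed norms -/

/-- The `ℓ^q` (quasi-)norm of a family of extended nonnegative numbers, `0 < q ≤ ∞`. -/
noncomputable def lqNorm {ι : Type} (q : ℝ≥0∞) (a : ι → ℝ≥0∞) : ℝ≥0∞ :=
  if q = ∞ then ⨆ i, a i else (∑' i, a i ^ q.toReal) ^ (1 / q.toReal)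

/-! ### Classical inhomogeneous Triebel-Lizorkin spaces -/

/-- Admissible pairs `(Φ, φ)` for the classical (isotropic, dyadic) spaces. -/
structure IsDyadicPair {d : ℕ} (Φ φ : 𝓢(E d, ℂ)) : Prop where
  supp_phi : Function.support (𝓕 φ : 𝓢(E d, ℂ)) ⊆ {ξ : E d | 1 / 2 ≤ ‖ξ‖ ∧ ‖ξ‖ ≤ 2}
  supp_Phi : Function.support (𝓕 Φ : 𝓢(E d, ℂ)) ⊆ {ξ : E d | ‖ξ‖ ≤ 2}
  lower_phi : ∃ c : ℝ, 0 < c ∧ ∀ ξ : E d, 3 / 5 ≤ ‖ξ‖ → ‖ξ‖ ≤ 5 / 3 → c ≤ ‖(𝓕 φ : 𝓢(E d, ℂ)) ξ‖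
  lower_Phi : ∃ c : ℝ, 0 < c ∧ ∀ ξ : E d, ‖ξ‖ ≤ 5 / 3 → c ≤ ‖(𝓕 Φ : 𝓢(E d, ℂ)) ξ‖

/-- The (quasi-)norm of the classical space `F^{α,q}_p`, with value `∞` off the space:
`‖Φ * f‖_{L^p} + ‖(∑_{ν ≥ 0} (2^{να} |φ_{2^ν I} * f|)^q)^{1/q}‖_{L^p}`. -/
noncomputable def normF {d : ℕ} (Φ φ : 𝓢(E d, ℂ)) (α : ℝ) (q : ℝ≥0∞) (p : ℝ)
    (f : 𝓢'(E d, ℂ)) : ℝ≥0∞ :=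
  eLpNorm (conv f Φ) (ENNReal.ofReal p) volume +
  eLpNorm (fun x : E d => lqNorm q fun ν : ℕ =>
      ENNReal.ofReal ((2 : ℝ) ^ ((ν : ℝ) * α)) * ‖conv f (dyadicDilate ν φ) x‖ₑ)
    (ENNReal.ofReal p) volume

/-! ### Dilation and shear matrices -/

/-- The anisotropic dilation matrix `A_(i)`: diagonal, `4` in position `i`, `2` elsewhere. -/
noncomputable def dilMat {d : ℕ} (i : Fin d) : GL (Fin d) ℝ where
  val := Matrix.diagonal fun m => if m = i then 4 else 2
  inv := Matrix.diagonal fun m => if m = i then 4⁻¹ else 2⁻¹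
  val_inv := by
    rw [Matrix.diagonal_mul_diagonal, ← Matrix.diagonal_one]
    congr 1; funext m; split_ifs <;> norm_num
  inv_val := by
    rw [Matrix.diagonal_mul_diagonal, ← Matrix.diagonal_one]
    congr 1; funext m; split_ifs <;> norm_num

/-- The off-diagonal part of a shear matrix: row `i` carries the shear parameters. -/
def shearOff {d : ℕ} (i : Fin d) (l : {m : Fin d // m ≠ i} → ℤ) : Matrix (Fin d) (Fin d) ℝ :=
  Matrix.of fun r c => if r = i then (if h : c ≠ i then (l ⟨c, h⟩ : ℝ) else 0) else 0

theorem shearOff_mul {d : ℕ} (i : Fin d) (l l' : {m : Fin d // m ≠ i} → ℤ) :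
    shearOff i l * shearOff i l' = 0 := by
  ext r c
  simp only [Matrix.mul_apply, shearOff, Matrix.of_apply, Matrix.zero_apply]
  refine Finset.sum_eq_zero fun m _ => ?_
  by_cases hm : m = i
  · simp [hm]
  · simp [hm]

theorem shearOff_neg {d : ℕ} (i : Fin d) (l : {m : Fin d // m ≠ i} → ℤ) :
    shearOff i (-l) = -shearOff i l := by
  ext r c
  simp only [shearOff, Matrix.of_apply, Matrix.neg_apply, Pi.neg_apply, Int.cast_neg]
  split_ifs <;> simp

/-- The shear matrix `B_(i)^{[ℓ]}`: ones on the diagonal, the shear parameters `ℓ` in the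
off-diagonal places of row `i`, zeros elsewhere. Its inverse is `B_(i)^{[-ℓ]}`. -/
noncomputable def shearMat {d : ℕ} (i : Fin d) (l : {m : Fin d // m ≠ i} → ℤ) :
    GL (Fin d) ℝ where
  val := 1 + shearOff i l
  inv := 1 + shearOff i (-l)
  val_inv := by
    rw [mul_add, add_mul, add_mul, shearOff_mul, shearOff_neg]; simp
  inv_val := by
    rw [mul_add, add_mul, add_mul, shearOff_mul, shearOff_neg]; simp

/-! ### Shearlets on the cones -/

/-- The frequency profile of the shearlet of direction `i`:
`ξ ↦ ψ₁^(ξ_i) ∏_{m ≠ i} ψ₂^(ξ_m / ξ_i)`. -/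
noncomputable def shearletSymbol {d : ℕ} (ψ₁ ψ₂ : ℝ → ℂ) (i : Fin d) (ξ : E d) : ℂ :=
  ψ₁ (ξ i) * ∏ m ∈ Finset.univ.erase i, ψ₂ (ξ m / ξ i)

/-- The functions `ψ₁^`, `ψ₂^` and `Ψ` generating a system of shearlets on the cones of `ℝ^d`.
The identity `|Ψ^|² χ_R + ∑_{i,j,ℓ} |ψ^(i)(ξ A_(i)^{-j} B_(i)^{[-ℓ]})|² χ_{D(i)} = 1` for almost
every `ξ` (with `R = [-1/8,1/8]^d` and `D(i)` the cones `|ξ_i| ≥ 1/8`, `|ξ_m| ≤ |ξ_i|`) is a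
consequence of the conditions listed here. -/
structure ShearletGenerators (d : ℕ) where
  psi1Hat : ℝ → ℂ
  psi2Hat : ℝ → ℂ
  Psi : 𝓢(E d, ℂ)
  smooth1 : ContDiff ℝ (⊤ : ℕ∞) psi1Hat
  smooth2 : ContDiff ℝ (⊤ : ℕ∞) psi2Hat
  supp1 : Function.support psi1Hat ⊆ Set.Icc (-1 / 2) (-1 / 16) ∪ Set.Icc (1 / 16) (1 / 2)
  supp2 : Function.support psi2Hat ⊆ Set.Icc (-1) 1
  scale_sum : ∀ w : ℝ, 1 / 8 ≤ |w| → HasSum (fun j : ℕ => ‖psi1Hat (w / 2 ^ (2 * j))‖ ^ 2) 1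
  shear_sum : ∀ w : ℝ, |w| ≤ 1 →
    ‖psi2Hat (w - 1)‖ ^ 2 + ‖psi2Hat w‖ ^ 2 + ‖psi2Hat (w + 1)‖ ^ 2 = 1
  supp_Psi : Function.support (𝓕 Psi : 𝓢(E d, ℂ)) ⊆ {ξ : E d | ∀ m, |ξ m| ≤ 1 / 4}
  Psi_eq : ∀ ξ : E d, (∀ m, |ξ m| ≤ 1 / 8) → ‖(𝓕 Psi : 𝓢(E d, ℂ)) ξ‖ = 1

namespace ShearletGenerators

theorem symbol_support {d : ℕ} (G : ShearletGenerators d) (i : Fin d) {ξ : E d}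
    (h : shearletSymbol G.psi1Hat G.psi2Hat i ξ ≠ 0) :
    1 / 16 ≤ |ξ i| ∧ ∀ m, |ξ m| ≤ 1 / 2 := by
  have h1 : G.psi1Hat (ξ i) ≠ 0 := left_ne_zero_of_mul h
  have h2 := right_ne_zero_of_mul h
  rw [Finset.prod_ne_zero_iff] at h2
  have hi : 1 / 16 ≤ |ξ i| ∧ |ξ i| ≤ 1 / 2 := by
    rcases G.supp1 h1 with h | h
    · rw [abs_of_nonpos (by linarith [h.2])]; constructor <;> linarith [h.1, h.2]
    · rw [abs_of_nonneg (by linarith [h.1])]; exact h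
  refine ⟨hi.1, fun m => ?_⟩
  by_cases hm : m = i
  · exact hm ▸ hi.2
  · have h3 := G.supp2 (h2 m (by simp [hm]))
    have h4 : |ξ m / ξ i| ≤ 1 := abs_le.2 h3
    rw [abs_div, div_le_one (by linarith [hi.1])] at h4
    exact h4.trans hi.2

theorem symbol_compact {d : ℕ} (G : ShearletGenerators d) (i : Fin d) :
    HasCompactSupport (shearletSymbol G.psi1Hat G.psi2Hat i) := by
  refine HasCompactSupport.of_support_subset_isCompact
    (ProperSpace.isCompact_closedBall (0 : E d) (Real.sqrt (∑ _m : Fin d, (1 / 2 : ℝ) ^ 2))) ?_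
  intro ξ hξ
  rw [mem_closedBall_zero_iff, EuclideanSpace.norm_eq]
  refine Real.sqrt_le_sqrt (Finset.sum_le_sum fun m _ => ?_)
  rw [Real.norm_eq_abs]
  exact pow_le_pow_left₀ (abs_nonneg _) ((G.symbol_support i hξ).2 m) 2

theorem symbol_smooth {d : ℕ} (G : ShearletGenerators d) (i : Fin d) :
    ContDiff ℝ (⊤ : ℕ∞) (shearletSymbol G.psi1Hat G.psi2Hat i) := by
  have hc : ∀ m : Fin d, ContDiff ℝ (⊤ : ℕ∞) fun ξ : E d => ξ m := fun m => by fun_prop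
  rw [contDiff_iff_contDiffAt]
  intro ξ
  by_cases h0 : ξ i = 0
  · have hev : shearletSymbol G.psi1Hat G.psi2Hat i =ᶠ[𝓝 ξ] fun _ => 0 := by
      have ho : ∀ᶠ η : E d in 𝓝 ξ, |η i| < 1 / 16 := by
        have : ContinuousAt (fun η : E d => |η i|) ξ := (hc i).continuous.abs.continuousAt
        refine this.eventually_lt continuousAt_const ?_
        simp [h0]
      filter_upwards [ho] with η hη
      by_contra hne
      exact absurd (G.symbol_support i hne).1 (not_le.2 hη)
    exact contDiffAt_const.congr_of_eventuallyEq hev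
  · unfold shearletSymbol
    refine ContDiffAt.mul (G.smooth1.comp (hc i)).contDiffAt ?_
    refine contDiffAt_prod fun m _ => ?_
    exact G.smooth2.contDiffAt.comp ξ ((hc m).contDiffAt.div (hc i).contDiffAt h0)

/-- The shearlet `ψ^(i)`: the Schwartz function whose Fourier transform is
`ξ ↦ ψ₁^(ξ_i) ∏_{m ≠ i} ψ₂^(ξ_m / ξ_i)`. -/
noncomputable def psi {d : ℕ} (G : ShearletGenerators d) (i : Fin d) : 𝓢(E d, ℂ) :=
  𝓕⁻ ((G.symbol_compact i).toSchwartzMap (G.symbol_smooth i))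

theorem fourier_psi {d : ℕ} (G : ShearletGenerators d) (i : Fin d) (ξ : E d) :
    (𝓕 (G.psi i) : 𝓢(E d, ℂ)) ξ =
      G.psi1Hat (ξ i) * ∏ m ∈ Finset.univ.erase i, G.psi2Hat (ξ m / ξ i) := by
  rw [psi, FourierTransform.fourier_fourierInv_eq]; rfl

end ShearletGenerators

/-- Indices `(i, j, ℓ)`: a direction `i`, a scale `j ≥ 0`, and shear parameters `ℓ ∈ ℤ^{d-1}`
(labelled by the coordinates different from `i`) with `|ℓ_m| ≤ 2^j`. -/
structure ShearIndex (d : ℕ) : Type where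
  dir : Fin d
  scale : ℕ
  shear : {m : Fin d // m ≠ dir} → ℤ
  bound : ∀ m, |shear m| ≤ 2 ^ scale

/-- The matrix `A_(i)^{-j} B_(i)^{[-ℓ]}`. -/
noncomputable def ShearIndex.mat {d : ℕ} (a : ShearIndex d) : GL (Fin d) ℝ :=
  (dilMat a.dir ^ a.scale)⁻¹ * (shearMat a.dir a.shear)⁻¹

/-- The measure `|Q_j| = 2^{-(d+1)j}` of the shear anisotropic cubes of scale `j`. -/
noncomputable def cubeVol (d j : ℕ) : ℝ := ((2 : ℝ) ^ ((d + 1) * j))⁻¹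

/-- The (quasi-)norm of the shear anisotropic space `F^{α,q}_p(AB)`, with value `∞` off the space:
`‖f * Ψ‖_{L^p} + ‖(∑_{i,j,ℓ} (|Q_j|^{-α} |ψ^(i)~_{A^{-j} B^{-ℓ}} * f|)^q)^{1/q}‖_{L^p}`. -/
noncomputable def normFAB {d : ℕ} (G : ShearletGenerators d) (α : ℝ) (q : ℝ≥0∞) (p : ℝ)
    (f : 𝓢'(E d, ℂ)) : ℝ≥0∞ :=
  eLpNorm (conv f G.Psi) (ENNReal.ofReal p) volume +
  eLpNorm (fun x : E d => lqNorm q fun a : ShearIndex d =>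
      ENNReal.ofReal (cubeVol d a.scale ^ (-α)) *
        ‖conv f (dilate a.mat (tilde (G.psi a.dir))) x‖ₑ)
    (ENNReal.ofReal p) volume

end ShearTL

namespace ShearTL

/-! The test functions are `f ν = s ν • φ(2^ν ·)`, with frequencies in the annulus `|ξ| ∼ 2^ν`. In
the classical space only the scales `μ` with `|μ - ν| ≤ 2` see them, and rescaling gives a norm
comparable to `‖s ν‖ 2^{ν(α₁ - d/p₁)}`. Taking `s ν = 2^{ν(d/p₁ - α₁)}` normalizes it.

A shearlet of scale `j` lives at frequencies `|ξ| ∼ 4^j`, so only boundedly many scales `j ≈ ν/2`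
interact with `f ν`. They carry about `2^{ν(d-1)/2}` shears, which costs `2^{ν(d-1)/(2q₂)}` in
`ℓ^{q₂}`; the weight `|Q_j|^{-α₂}` costs `2^{ν(d+1)α₂/2}`. Each matrix `A^{-j}B^{[-ℓ]}` contracts by
`2^{-j}` uniformly in `ℓ`, so every convolution with `φ(2^ν ·)` is at most `C(1 + 2^{ν/2}|x|)^{-N}`,
whose `L^{p₂}` norm is of order `2^{-νd/(2p₂)}`. No cancellation is needed beyond disjointness of
frequency supports. The product of these factors with `s ν` is `2^{δν}`, where `2δ` is the left side
minus the right side of the hypothesis, so `δ < 0`.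

The lemmas that carry this are `conv_linDilate_decay` (pointwise decay), `eLpNorm_lqNorm_le`
(counting and rescaling), `fourier_shearlet_ne_zero` and `norm_mat_apply_le` (geometry of the
matrices). -/

/-- The `L¹`-normalized dilation `x ↦ |det L|⁻¹ g (L⁻¹ x)` by a linear automorphism. -/
noncomputable def linDilate {d : ℕ} (L : E d ≃L[ℝ] E d) (g : 𝓢(E d, ℂ)) : 𝓢(E d, ℂ) :=
  ((|LinearMap.det (L : E d →ₗ[ℝ] E d)|⁻¹ : ℝ) : ℂ) •
    SchwartzMap.compCLMOfContinuousLinearEquiv ℂ L.symm g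

theorem linDilate_apply {d : ℕ} (L : E d ≃L[ℝ] E d) (g : 𝓢(E d, ℂ)) (x : E d) :
    linDilate L g x = ((|LinearMap.det (L : E d →ₗ[ℝ] E d)|⁻¹ : ℝ) : ℂ) * g (L.symm x) := rfl

theorem integral_inv_det_mul_comp_symm {d : ℕ} (L : E d ≃L[ℝ] E d) (F : E d → ℂ) :
    ∫ x, ((|LinearMap.det (L : E d →ₗ[ℝ] E d)|⁻¹ : ℝ) : ℂ) * F (L.symm x) = ∫ u, F u := by
  have hL : LinearMap.det (L : E d →ₗ[ℝ] E d) ≠ 0 := (LinearEquiv.isUnit_det' L.toLinearEquiv).ne_zero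
  have hdet : LinearMap.det (L.symm : E d →ₗ[ℝ] E d) = (LinearMap.det (L : E d →ₗ[ℝ] E d))⁻¹ :=
    LinearEquiv.det_coe_symm L.toLinearEquiv
  have hS : LinearMap.det (L.symm : E d →ₗ[ℝ] E d) ≠ 0 := by rw [hdet]; exact inv_ne_zero hL
  have hmap := Measure.map_linearMap_addHaar_eq_smul_addHaar (volume : Measure (E d)) hS
  have h1 : ∫ x, F (L.symm x) = ∫ y, F y ∂(Measure.map (L.symm : E d →ₗ[ℝ] E d) volume) :=
    (integral_map_equiv L.symm.toHomeomorph.toMeasurableEquiv F).symm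
  rw [integral_const_mul, h1, hmap, integral_smul_measure, hdet, inv_inv,
    ENNReal.toReal_ofReal (abs_nonneg _), Complex.real_smul, ← mul_assoc, ← Complex.ofReal_mul,
    inv_mul_cancel₀ (abs_ne_zero.2 hL)]
  simp

/-! ### Convolutions of Schwartz functions and their Fourier supports. -/

theorem conv_coe_apply {d : ℕ} (f g : 𝓢(E d, ℂ)) (x : E d) :
    conv (f : 𝓢'(E d, ℂ)) g x = ∫ y, g (x - y) * f y := by
  refine (SchwartzMap.toTemperedDistributionCLM_apply_apply volume f
    ((reflect g).compSubConstCLM ℂ x)).trans ?_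
  refine integral_congr_ae (Eventually.of_forall fun y => ?_)
  change g (-(y - x)) * f y = g (x - y) * f y
  rw [neg_sub]

theorem conv_coe_apply' {d : ℕ} (f g : 𝓢(E d, ℂ)) (x : E d) :
    conv (f : 𝓢'(E d, ℂ)) g x = ∫ y, g y * f (x - y) := by
  rw [conv_coe_apply, ← integral_sub_left_eq_self (fun y => g y * f (x - y)) volume x]
  simp

theorem conv_linDilate {d : ℕ} (L : E d ≃L[ℝ] E d) (f g : 𝓢(E d, ℂ)) (x : E d) :
    conv (f : 𝓢'(E d, ℂ)) (linDilate L g) x = ∫ u, g u * f (x - L u) := by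
  rw [conv_coe_apply', ← integral_inv_det_mul_comp_symm L fun u => g u * f (x - L u)]
  simp [linDilate_apply, mul_assoc]

theorem conv_smul {d : ℕ} (s : ℂ) (f g : 𝓢(E d, ℂ)) (x : E d) :
    conv ((s • f : 𝓢(E d, ℂ)) : 𝓢'(E d, ℂ)) g x = s * conv (f : 𝓢'(E d, ℂ)) g x := by
  rw [conv_coe_apply, conv_coe_apply, ← integral_const_mul]
  refine integral_congr_ae (Eventually.of_forall fun y => ?_)
  simp only [_root_.smul_apply, smul_eq_mul]
  ring

theorem conv_eq_convolution {d : ℕ} (f g : 𝓢(E d, ℂ)) :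
    conv (f : 𝓢'(E d, ℂ)) g = SchwartzMap.convolution (ContinuousLinearMap.mul ℂ ℂ) f g := by
  ext x
  rw [SchwartzMap.convolution_apply, conv_coe_apply, convolution]
  simp [mul_comm]

theorem fourier_convolution_mul {d : ℕ} (f g : 𝓢(E d, ℂ)) (ξ : E d) :
    (𝓕 (SchwartzMap.convolution (ContinuousLinearMap.mul ℂ ℂ) f g) : 𝓢(E d, ℂ)) ξ =
      (𝓕 f : 𝓢(E d, ℂ)) ξ * (𝓕 g : 𝓢(E d, ℂ)) ξ := by
  rw [SchwartzMap.fourier_convolution]; rfl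

theorem conv_eq_zero_of_fourier {d : ℕ} (f g : 𝓢(E d, ℂ))
    (h : ∀ ξ, (𝓕 f : 𝓢(E d, ℂ)) ξ ≠ 0 → (𝓕 g : 𝓢(E d, ℂ)) ξ = 0) (x : E d) :
    conv (f : 𝓢'(E d, ℂ)) g x = 0 := by
  have h0 : (𝓕 (SchwartzMap.convolution (ContinuousLinearMap.mul ℂ ℂ) f g) : 𝓢(E d, ℂ)) = 0 := by
    ext ξ
    rw [fourier_convolution_mul]
    by_cases hf : (𝓕 f : 𝓢(E d, ℂ)) ξ = 0
    · simp [hf]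
    · simp [h ξ hf]
  rw [conv_eq_convolution, ← FourierTransform.fourierInv_fourier_eq
    (F := 𝓢(E d, ℂ)) (SchwartzMap.convolution (ContinuousLinearMap.mul ℂ ℂ) f g), h0]
  simp [FourierTransform.fourierInv_zero]

/-- Here `η` plays the role of `Lᵀ ξ`. Specifying it through the pairing lets homotheties and
matrices supply it directly, without forming an adjoint. -/
theorem fourier_linDilate {d : ℕ} (L : E d ≃L[ℝ] E d) (g : 𝓢(E d, ℂ)) {ξ η : E d}
    (h : ∀ v, inner ℝ (L v) ξ = inner ℝ v η) :
    (𝓕 (linDilate L g) : 𝓢(E d, ℂ)) ξ = (𝓕 g : 𝓢(E d, ℂ)) η := by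
  rw [SchwartzMap.fourier_coe, SchwartzMap.fourier_coe, Real.fourier_eq, Real.fourier_eq,
    ← integral_inv_det_mul_comp_symm L fun v => Real.fourierChar (-inner ℝ v η) • g v]
  refine integral_congr_ae (Eventually.of_forall fun y => ?_)
  simp only [linDilate_apply, ← h, L.apply_symm_apply, Circle.smul_def, smul_eq_mul]
  ring

theorem fourier_tilde {d : ℕ} (g : 𝓢(E d, ℂ)) (ξ : E d) :
    (𝓕 (tilde g) : 𝓢(E d, ℂ)) ξ = starRingEnd ℂ ((𝓕 g : 𝓢(E d, ℂ)) ξ) := by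
  rw [SchwartzMap.fourier_coe, SchwartzMap.fourier_coe, Real.fourier_eq, Real.fourier_eq,
    ← integral_conj, ← integral_neg_eq_self]
  refine integral_congr_ae (Eventually.of_forall fun y => ?_)
  have : tilde g (-y) = starRingEnd ℂ (g y) := by
    change starRingEnd ℂ (g (- -y)) = _
    rw [neg_neg]
  simp only [this, Circle.smul_def, smul_eq_mul, map_mul, inner_neg_left, AddChar.map_neg_eq_inv,
    inv_inv, Circle.coe_inv_eq_conj, Complex.conj_conj]

/-! ### Uniform decay of convolutions with dilated kernels. -/

theorem exists_one_add_norm_pow_mul_le {d : ℕ} (f : 𝓢(E d, ℂ)) (N : ℕ) :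
    ∃ C : ℝ, 0 ≤ C ∧ ∀ x, (1 + ‖x‖) ^ N * ‖f x‖ ≤ C := by
  have h := fun x => SchwartzMap.one_add_le_sup_seminorm_apply (𝕜 := ℝ) (m := (N, 0))
    (k := N) (n := 0) le_rfl le_rfl f x
  simp only [norm_iteratedFDeriv_zero] at h
  exact ⟨_, le_trans (by positivity) (h 0), h⟩

/-- Both factors are concentrated within distance of order `1/R`: the kernel because `L` contracts
by `K/R`, the function because `R ≤ K Λ`. The point is that `C` depends on `K` but not on `L`, `R`,
`Λ`, hence is uniform over scales and shears. -/
theorem conv_linDilate_decay {d : ℕ} (f g : 𝓢(E d, ℂ)) (N : ℕ) (K : ℝ) (hK : 1 ≤ K) :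
    ∃ C : ℝ, 0 ≤ C ∧ ∀ (L : E d ≃L[ℝ] E d) (R Λ : ℝ), 0 ≤ R → 0 ≤ Λ → R ≤ K * Λ →
      (∀ u, R * ‖L u‖ ≤ K * ‖u‖) → ∀ f' : 𝓢(E d, ℂ), (∀ z, f' z = f (Λ • z)) → ∀ x,
      ‖conv (f' : 𝓢'(E d, ℂ)) (linDilate L g) x‖ ≤ C * (1 + ‖R • x‖) ^ (-(N : ℝ)) := by
  obtain ⟨Cf, hCf, hf⟩ := exists_one_add_norm_pow_mul_le f N
  set M := (volume : Measure (E d)).integrablePower with hM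
  -- `N` powers pay for the decay in `x`, the other `M` make the integral in `u` converge.
  obtain ⟨Cg, hCg, hg⟩ := exists_one_add_norm_pow_mul_le g (N + M)
  have hI := Measure.integrable_pow_neg_integrablePower (volume : Measure (E d))
  have hw (u : E d) : 0 < 1 + ‖u‖ := by positivity
  refine ⟨K ^ (2 * N) * Cf * Cg * ∫ u : E d, (1 + ‖u‖) ^ (-(M : ℝ)), ?_, ?_⟩
  · have : 0 ≤ ∫ u : E d, (1 + ‖u‖) ^ (-(M : ℝ)) :=
      integral_nonneg fun u => Real.rpow_nonneg (hw u).le _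
    positivity
  intro L R Λ hR hΛ hRΛ hL f' hf' x
  rw [conv_linDilate]
  have hx : 0 < 1 + ‖R • x‖ := hw _
  have key (u : E d) : ‖g u * f' (x - L u)‖ ≤
      (K ^ (2 * N) * Cf * Cg * (1 + ‖R • x‖) ^ (-(N : ℝ))) * (1 + ‖u‖) ^ (-(M : ℝ)) := by
    -- A Peetre-type inequality, from `x = L u + (x - L u)` and `1 + a + b ≤ (1 + a)(1 + b)`.
    have h1 : 1 + ‖R • x‖ ≤ (K * (1 + ‖u‖)) * (K * (1 + ‖Λ • (x - L u)‖)) := by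
      have e1 : ‖R • x‖ = R * ‖x‖ := by rw [norm_smul, Real.norm_of_nonneg hR]
      have e2 : ‖Λ • (x - L u)‖ = Λ * ‖x - L u‖ := by rw [norm_smul, Real.norm_of_nonneg hΛ]
      have e3 : ‖x‖ ≤ ‖L u‖ + ‖x - L u‖ := by simpa using norm_add_le (L u) (x - L u)
      have e4 : 1 + R * ‖L u‖ ≤ K * (1 + ‖u‖) := by linarith [hL u]
      have e5 : 1 + R * ‖x - L u‖ ≤ K * (1 + Λ * ‖x - L u‖) := by
        nlinarith [mul_le_mul_of_nonneg_right hRΛ (norm_nonneg (x - L u))]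
      rw [e1, e2]
      calc 1 + R * ‖x‖ ≤ (1 + R * ‖L u‖) * (1 + R * ‖x - L u‖) := by
            have := mul_le_mul_of_nonneg_left e3 hR
            have : 0 ≤ (R * ‖L u‖) * (R * ‖x - L u‖) := by positivity
            nlinarith
        _ ≤ _ := by gcongr
    have h2 := pow_le_pow_left₀ hx.le h1 N
    have h3 := hf (Λ • (x - L u))
    have h4 := hg u
    have h5 : ‖g u‖ * ‖f (Λ • (x - L u))‖ * ((1 + ‖u‖) ^ M * (1 + ‖R • x‖) ^ N) ≤
        K ^ (2 * N) * Cf * Cg := by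
      calc _ ≤ ‖g u‖ * ‖f (Λ • (x - L u))‖ *
            ((1 + ‖u‖) ^ M * ((K * (1 + ‖u‖)) * (K * (1 + ‖Λ • (x - L u)‖))) ^ N) := by gcongr
        _ = K ^ (2 * N) * ((1 + ‖Λ • (x - L u)‖) ^ N * ‖f (Λ • (x - L u))‖) *
            ((1 + ‖u‖) ^ (N + M) * ‖g u‖) := by simp only [mul_pow]; ring
        _ ≤ _ := by gcongr
    rw [norm_mul, hf', Real.rpow_neg hx.le, Real.rpow_neg (hw u).le, Real.rpow_natCast,
      Real.rpow_natCast, ← div_eq_mul_inv, ← div_eq_mul_inv, div_div,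
      le_div_iff₀ (by positivity), mul_comm ((1 + ‖R • x‖) ^ N)]
    exact h5
  refine (norm_integral_le_of_norm_le (hI.const_mul _) (Eventually.of_forall key)).trans ?_
  rw [integral_const_mul]
  exact le_of_eq (by ring)

/-! ### Mixed norms -/

theorem le_lqNorm {ι : Type} {q : ℝ≥0∞} (hq : 0 < q) (a : ι → ℝ≥0∞) (i : ι) :
    a i ≤ lqNorm q a := by
  unfold lqNorm
  split_ifs with h
  · exact le_iSup a i
  · have hq' : 0 < q.toReal := ENNReal.toReal_pos hq.ne' h
    calc a i = (a i ^ q.toReal) ^ (1 / q.toReal) := by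
          rw [← ENNReal.rpow_mul, mul_one_div_cancel hq'.ne', ENNReal.rpow_one]
      _ ≤ _ := ENNReal.rpow_le_rpow (ENNReal.le_tsum i) (by positivity)

/-- At `q = ∞` the exponent `(q⁻¹).toReal` is `0`, so the counting factor is `1`. The injection `e`
allows counting in a type where finite sets of labels are easily written down. -/
theorem lqNorm_le_card_rpow_mul {ι κ : Type} {q : ℝ≥0∞} (hq : 0 < q) (a : ι → ℝ≥0∞)
    {e : ι → κ} (he : Function.Injective e) (T : Finset κ) (hT : ∀ i, a i ≠ 0 → e i ∈ T)
    {B : ℝ≥0∞} (hB : ∀ i, a i ≤ B) :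
    lqNorm q a ≤ (T.card : ℝ≥0∞) ^ (q⁻¹).toReal * B := by
  unfold lqNorm
  split_ifs with h
  · simpa [h] using hB
  · have hq' : 0 < q.toReal := ENNReal.toReal_pos hq.ne' h
    have hsum : ∑' i, a i ^ q.toReal ≤ T.card * B ^ q.toReal := by
      rw [tsum_eq_sum (s := T.preimage e he.injOn)]
      · calc _ ≤ ∑ i ∈ T.preimage e he.injOn, B ^ q.toReal :=
              Finset.sum_le_sum fun i _ => ENNReal.rpow_le_rpow (hB i) hq'.le
          _ = ((T.preimage e he.injOn).card : ℝ≥0∞) * B ^ q.toReal := by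
              rw [Finset.sum_const, nsmul_eq_mul]
          _ ≤ _ := by
              gcongr
              exact Finset.card_le_card_of_injOn e (fun i hi => by simpa using hi) he.injOn
      · intro i hi
        have : a i = 0 := by
          by_contra hne
          exact hi (by simpa using hT i hne)
        rw [this, ENNReal.zero_rpow_of_pos hq']
    calc _ ≤ ((T.card : ℝ≥0∞) * B ^ q.toReal) ^ (1 / q.toReal) :=
          ENNReal.rpow_le_rpow hsum (by positivity)
      _ = _ := by
          rw [ENNReal.mul_rpow_of_nonneg _ _ (by positivity), ← ENNReal.rpow_mul,
            mul_one_div_cancel hq'.ne', ENNReal.rpow_one, ENNReal.toReal_inv, one_div]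

/-- Since the homothety is a measurable equivalence, `F` need not be measurable. -/
theorem lintegral_comp_smul_euclidean {d : ℕ} (F : E d → ℝ≥0∞) {R : ℝ} (hR : 0 < R) :
    ∫⁻ x, F (R • x) = ENNReal.ofReal (R ^ (-(d : ℝ))) * ∫⁻ x, F x := by
  calc ∫⁻ x, F (R • x) = ∫⁻ y, F y ∂(Measure.map (fun x => R • x) volume) :=
        (lintegral_map_equiv F
          (Homeomorph.smul (isUnit_iff_ne_zero.2 hR.ne').unit).toMeasurableEquiv).symm
    _ = _ := by
        rw [Measure.map_addHaar_smul volume hR.ne', lintegral_smul_measure, finrank_euclideanSpace,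
          Fintype.card_fin, abs_of_pos (by positivity), Real.rpow_neg hR.le, Real.rpow_natCast,
          smul_eq_mul]

theorem eLpNorm_comp_smul_euclidean {d : ℕ} {ε : Type} [TopologicalSpace ε] [ContinuousENorm ε]
    (F : E d → ε) {R p : ℝ} (hR : 0 < R) (hp : 0 < p) :
    eLpNorm (fun x => F (R • x)) (ENNReal.ofReal p) volume =
      ENNReal.ofReal (R ^ (-(d / p))) * eLpNorm F (ENNReal.ofReal p) volume := by
  have hp0 : ENNReal.ofReal p ≠ 0 := by simpa using hp
  rw [eLpNorm_eq_lintegral_rpow_enorm_toReal hp0 ENNReal.ofReal_ne_top,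
    eLpNorm_eq_lintegral_rpow_enorm_toReal hp0 ENNReal.ofReal_ne_top, ENNReal.toReal_ofReal hp.le,
    lintegral_comp_smul_euclidean (fun x => ‖F x‖ₑ ^ p) hR,
    ENNReal.mul_rpow_of_nonneg _ _ (by positivity),
    ENNReal.ofReal_rpow_of_nonneg (by positivity) (by positivity), ← Real.rpow_mul hR.le]
  congr 3
  ring

theorem eLpNorm_lqNorm_le {d N : ℕ} {ι κ : Type} {q : ℝ≥0∞} (hq : 0 < q) {p : ℝ} (hp : 0 < p)
    {e : ι → κ} (he : Function.Injective e) (T : Finset κ) {R : ℝ} (hR : 0 < R)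
    (w : ι → ℝ) (H : ι → E d → ℂ) {B : ℝ} (hB : 0 ≤ B) (hT : ∀ i x, H i x ≠ 0 → e i ∈ T)
    (hH : ∀ i, e i ∈ T → ∀ x, w i * ‖H i x‖ ≤ B * (1 + ‖R • x‖) ^ (-(N : ℝ))) :
    eLpNorm (fun x => lqNorm q fun i => ENNReal.ofReal (w i) * ‖H i x‖ₑ) (ENNReal.ofReal p)
        volume ≤
      ENNReal.ofReal ((T.card : ℝ) ^ (q⁻¹).toReal * B * R ^ (-(d / p))) *
        eLpNorm (fun x : E d => (1 + ‖x‖) ^ (-(N : ℝ))) (ENNReal.ofReal p) volume := by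
  have hpt (x : E d) : ‖lqNorm q fun i => ENNReal.ofReal (w i) * ‖H i x‖ₑ‖ₑ ≤
      (((T.card : ℝ) ^ (q⁻¹).toReal * B).toNNReal : ℝ≥0∞) *
        ‖(fun y : E d => (1 + ‖y‖) ^ (-(N : ℝ))) (R • x)‖ₑ := by
    have hw : 0 ≤ (1 + ‖R • x‖) ^ (-(N : ℝ)) := by positivity
    rw [enorm_eq_self]
    refine (lqNorm_le_card_rpow_mul hq _ he T (B := ENNReal.ofReal
      (B * (1 + ‖R • x‖) ^ (-(N : ℝ)))) (fun i hi => hT i x ?_) fun i => ?_).trans_eq ?_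
    · rintro h0
      simp [h0] at hi
    · by_cases hi : e i ∈ T
      · rw [← ofReal_norm, ← ENNReal.ofReal_mul' (norm_nonneg _)]
        exact ENNReal.ofReal_le_ofReal (hH i hi x)
      · have h0 : H i x = 0 := by
          by_contra h
          exact hi (hT i x h)
        simp [h0]
    · rw [Real.enorm_of_nonneg hw, ← ENNReal.ofReal, ENNReal.ofReal_mul hB,
        ENNReal.ofReal_mul (by positivity), ← ENNReal.ofReal_rpow_of_nonneg (x := (T.card : ℝ)) (by positivity) (by positivity),
        ENNReal.ofReal_natCast, mul_assoc]
  refine (eLpNorm_le_mul_eLpNorm_of_ae_le_mul' (Eventually.of_forall hpt) _).trans_eq ?_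
  rw [eLpNorm_comp_smul_euclidean (fun y : E d => (1 + ‖y‖) ^ (-(N : ℝ))) hR hp, ← mul_assoc,
    ← ENNReal.ofReal, ← ENNReal.ofReal_mul (by positivity)]

/-! ### Dyadic and shear dilations as linear dilations -/

/-- The homothety of ratio `2^{-ν}`. -/
noncomputable def dyadicScale (d ν : ℕ) : E d ≃L[ℝ] E d :=
  ContinuousLinearEquiv.smulLeft (R₁ := ℝ) (M₁ := E d)
    (Units.mk0 ((2 : ℝ) ^ ν) (pow_ne_zero ν two_ne_zero))⁻¹

theorem dyadicScale_apply (d ν : ℕ) (x : E d) : dyadicScale d ν x = ((2 : ℝ) ^ ν)⁻¹ • x := rfl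

theorem compDyadic_apply {d : ℕ} (ν : ℕ) (g : 𝓢(E d, ℂ)) (x : E d) :
    compDyadic ν g x = g ((2 : ℝ) ^ ν • x) := rfl

theorem det_dyadicScale (d ν : ℕ) :
    LinearMap.det (dyadicScale d ν : E d →ₗ[ℝ] E d) = ((2 : ℝ) ^ (d * ν))⁻¹ := by
  have : (dyadicScale d ν : E d →ₗ[ℝ] E d) = ((2 : ℝ) ^ ν)⁻¹ • LinearMap.id := rfl
  rw [this, LinearMap.det_smul, LinearMap.det_id, finrank_euclideanSpace, Fintype.card_fin,
    mul_one, inv_pow, ← pow_mul, mul_comm]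

theorem dyadicScale_symm_apply (d ν : ℕ) (x : E d) :
    (dyadicScale d ν).symm x = (2 : ℝ) ^ ν • x := by
  rw [ContinuousLinearEquiv.symm_apply_eq, dyadicScale_apply, smul_smul,
    inv_mul_cancel₀ (by positivity), one_smul]

theorem dyadicDilate_eq_linDilate {d : ℕ} (ν : ℕ) (g : 𝓢(E d, ℂ)) :
    dyadicDilate ν g = linDilate (dyadicScale d ν) g := by
  ext x
  rw [linDilate_apply, det_dyadicScale, dyadicScale_symm_apply]
  change (2 : ℂ) ^ (d * ν) * g ((2 : ℝ) ^ ν • x) = _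
  rw [abs_of_pos (by positivity), inv_inv]
  push_cast
  rfl

theorem inner_dyadicScale {d : ℕ} (ν : ℕ) (v ξ : E d) :
    inner ℝ (dyadicScale d ν v) ξ = inner ℝ v (((2 : ℝ) ^ ν)⁻¹ • ξ) := by
  rw [dyadicScale_apply, real_inner_smul_left, real_inner_smul_right]

theorem fourier_dyadicDilate {d : ℕ} (ν : ℕ) (g : 𝓢(E d, ℂ)) (ξ : E d) :
    (𝓕 (dyadicDilate ν g) : 𝓢(E d, ℂ)) ξ = (𝓕 g : 𝓢(E d, ℂ)) (((2 : ℝ) ^ ν)⁻¹ • ξ) := by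
  rw [dyadicDilate_eq_linDilate]
  exact fourier_linDilate _ _ fun v => inner_dyadicScale ν v ξ

theorem fourier_dyadicDilate_ne_zero {d : ℕ} {Φ φ : 𝓢(E d, ℂ)} (hφ : IsDyadicPair Φ φ) (ν : ℕ)
    {ξ : E d} (h : (𝓕 (dyadicDilate ν φ) : 𝓢(E d, ℂ)) ξ ≠ 0) :
    (2 : ℝ) ^ ν ≤ 2 * ‖ξ‖ ∧ ‖ξ‖ ≤ 2 * 2 ^ ν := by
  rw [fourier_dyadicDilate] at h
  obtain ⟨h1, h2⟩ := hφ.supp_phi h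
  have h0 : (0 : ℝ) < 2 ^ ν := by positivity
  rw [norm_smul, norm_inv, norm_pow, Real.norm_ofNat, inv_mul_eq_div] at h1 h2
  rw [le_div_iff₀ h0] at h1
  rw [div_le_iff₀ h0] at h2
  constructor <;> linarith

theorem compDyadic_eq_smul_dyadicDilate {d : ℕ} (ν : ℕ) (g : 𝓢(E d, ℂ)) :
    compDyadic ν g = ((2 : ℂ) ^ (d * ν))⁻¹ • dyadicDilate ν g := by
  rw [dyadicDilate, smul_smul, inv_mul_cancel₀ (pow_ne_zero _ two_ne_zero), one_smul]

theorem fourier_compDyadic_ne_zero {d : ℕ} {Φ φ : 𝓢(E d, ℂ)} (hφ : IsDyadicPair Φ φ) (ν : ℕ)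
    {ξ : E d} (h : (𝓕 (compDyadic ν φ) : 𝓢(E d, ℂ)) ξ ≠ 0) :
    (2 : ℝ) ^ ν ≤ 2 * ‖ξ‖ ∧ ‖ξ‖ ≤ 2 * 2 ^ ν := by
  refine fourier_dyadicDilate_ne_zero hφ ν fun h0 => h ?_
  rw [compDyadic_eq_smul_dyadicDilate, FourierTransform.fourier_smul, _root_.smul_apply, h0,
    smul_zero]

theorem conv_compDyadic_dyadicDilate {d : ℕ} (ν : ℕ) (f g : 𝓢(E d, ℂ)) (x : E d) :
    conv (compDyadic ν f : 𝓢'(E d, ℂ)) (dyadicDilate ν g) x =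
      conv (f : 𝓢'(E d, ℂ)) g ((2 : ℝ) ^ ν • x) := by
  rw [dyadicDilate_eq_linDilate, conv_linDilate, conv_coe_apply']
  refine integral_congr_ae (Eventually.of_forall fun u => ?_)
  simp only [compDyadic_apply, dyadicScale_apply, smul_sub, smul_smul]
  rw [mul_inv_cancel₀ (by positivity), one_smul]

theorem det_euclEquiv {d : ℕ} (M : GL (Fin d) ℝ) :
    LinearMap.det (euclEquiv M : E d →ₗ[ℝ] E d) = (M : Matrix (Fin d) (Fin d) ℝ).det := by
  have : (euclEquiv M : E d →ₗ[ℝ] E d) =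
      Matrix.toEuclideanLin (M : Matrix (Fin d) (Fin d) ℝ) := rfl
  rw [this, Matrix.toEuclideanLin_eq_toLin_orthonormal, LinearMap.det_toLin]

theorem dilate_eq_linDilate {d : ℕ} (M : GL (Fin d) ℝ) (g : 𝓢(E d, ℂ)) :
    dilate M g = linDilate (euclEquiv M) g := by
  have : euclEquiv M⁻¹ = (euclEquiv M).symm := by
    simp only [euclEquiv, map_inv]; rfl
  rw [dilate, linDilate, det_euclEquiv, this]

theorem euclEquiv_apply {d : ℕ} (M : GL (Fin d) ℝ) (x : E d) (m : Fin d) :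
    euclEquiv M x m = ((M : Matrix (Fin d) (Fin d) ℝ).mulVec x) m := rfl

theorem inner_euclEquiv {d : ℕ} (M : GL (Fin d) ℝ) (v ξ : E d) :
    inner ℝ (euclEquiv M v) ξ =
      inner ℝ v (Matrix.toEuclideanCLM (𝕜 := ℝ) (M : Matrix (Fin d) (Fin d) ℝ).transpose ξ) := by
  have : euclEquiv M v = Matrix.toEuclideanCLM (𝕜 := ℝ) (M : Matrix (Fin d) (Fin d) ℝ) v := rfl
  rw [this, Matrix.inner_toEuclideanCLM, real_inner_comm, Matrix.inner_toEuclideanCLM,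
    Matrix.mulVec_transpose, Matrix.dotProduct_mulVec, dotProduct_comm]

/-! ### Shear dilations -/

theorem coe_mat {d : ℕ} (a : ShearIndex d) : (a.mat : Matrix (Fin d) (Fin d) ℝ) =
    Matrix.diagonal (fun m => if m = a.dir then ((4 : ℝ) ^ a.scale)⁻¹ else (2 ^ a.scale)⁻¹) *
      (1 + shearOff a.dir (-a.shear)) := by
  have : ((dilMat a.dir ^ a.scale)⁻¹ : GL (Fin d) ℝ) = (dilMat a.dir)⁻¹ ^ a.scale :=
    (inv_pow _ _).symm
  rw [ShearIndex.mat, this, Units.val_mul, Units.val_pow_eq_pow_val]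
  change Matrix.diagonal (fun m => if m = a.dir then (4 : ℝ)⁻¹ else 2⁻¹) ^ a.scale * _ = _
  rw [Matrix.diagonal_pow]
  congr 2
  funext m
  rw [Pi.pow_apply]
  split_ifs <;> rw [inv_pow]

theorem shearOff_transpose_mulVec {d : ℕ} (i : Fin d) (l : {m : Fin d // m ≠ i} → ℤ)
    (v : Fin d → ℝ) (m : Fin d) :
    (shearOff i l).transpose.mulVec v m = shearOff i l i m * v i := by
  rw [Matrix.mulVec, dotProduct, Finset.sum_eq_single i]
  · rfl
  · intro r _ hr
    simp [shearOff, hr]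
  · simp

theorem mat_transpose_apply {d : ℕ} (a : ShearIndex d) (ξ : E d) (m : Fin d) :
    Matrix.toEuclideanCLM (𝕜 := ℝ) (a.mat : Matrix (Fin d) (Fin d) ℝ).transpose ξ m =
      (if m = a.dir then ((4 : ℝ) ^ a.scale)⁻¹ else (2 ^ a.scale)⁻¹) * ξ m +
        shearOff a.dir (-a.shear) a.dir m * ((4 ^ a.scale)⁻¹ * ξ a.dir) := by
  change ((a.mat : Matrix (Fin d) (Fin d) ℝ).transpose.mulVec ξ) m = _
  rw [coe_mat, Matrix.transpose_mul, ← Matrix.mulVec_mulVec, Matrix.diagonal_transpose,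
    Matrix.transpose_add, Matrix.transpose_one, Matrix.add_mulVec, Matrix.one_mulVec, Pi.add_apply,
    shearOff_transpose_mulVec, Matrix.mulVec_diagonal, Matrix.mulVec_diagonal, if_pos rfl]

theorem abs_shearOff_le {d : ℕ} (a : ShearIndex d) (m r : Fin d) :
    |shearOff a.dir (-a.shear) m r| ≤ 2 ^ a.scale := by
  simp only [shearOff, Matrix.of_apply]
  split_ifs with h1 h2
  · have := a.bound ⟨r, h2⟩
    rw [Pi.neg_apply, Int.cast_neg, abs_neg, ← Int.cast_abs]
    exact_mod_cast this
  all_goals simp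

theorem norm_le_of_forall_abs_le {d : ℕ} {x : E d} {B : ℝ} (h : ∀ m, |x m| ≤ B) :
    ‖x‖ ≤ d * B := by
  rcases Nat.eq_zero_or_pos d with rfl | hd
  · simp [Subsingleton.elim x 0]
  have hB : 0 ≤ B := (abs_nonneg _).trans (h ⟨0, hd⟩)
  have hd' : (1 : ℝ) ≤ d := by exact_mod_cast hd
  rw [EuclideanSpace.norm_eq]
  refine Real.sqrt_le_iff.2 ⟨by positivity, ?_⟩
  calc ∑ m, ‖x m‖ ^ 2 ≤ ∑ _m : Fin d, B ^ 2 := by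
        gcongr with m
        exact h m
    _ = d * B ^ 2 := by simp
    _ ≤ d * (d * B ^ 2) := le_mul_of_one_le_left (by positivity) hd' |>.trans_eq (by ring)
    _ = _ := by ring

theorem abs_apply_le_norm {d : ℕ} (x : E d) (m : Fin d) : |x m| ≤ ‖x‖ :=
  PiLp.norm_apply_le x m

/-- With `M = a.mat` and `η = Mᵀ ξ` one has `η_i = 4^{-j} ξ_i` and `η_m = 2^{-j} ξ_m - ℓ_m 4^{-j}
ξ_i`. The lower bound comes from `|η_i| ≥ 1/16`. For the upper bound, `|ℓ_m| ≤ 2^j` and `|η_m| ≤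
1/2` give `|ξ_m| ≤ 4^j`, so the restriction on the shears is essential. -/
theorem fourier_shearlet_ne_zero {d : ℕ} (G : ShearletGenerators d) (a : ShearIndex d) {ξ : E d}
    (h : (𝓕 (dilate a.mat (tilde (G.psi a.dir))) : 𝓢(E d, ℂ)) ξ ≠ 0) :
    (4 : ℝ) ^ a.scale ≤ 16 * ‖ξ‖ ∧ ‖ξ‖ ≤ d * 4 ^ a.scale := by
  rw [dilate_eq_linDilate, fourier_linDilate _ _ fun v => inner_euclEquiv a.mat v ξ,
    fourier_tilde, map_ne_zero, G.fourier_psi] at h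
  obtain ⟨h1, h2⟩ := G.symbol_support a.dir h
  have h4 : (0 : ℝ) < 4 ^ a.scale := by positivity
  have h20 : (1 : ℝ) ≤ 2 ^ a.scale := one_le_pow₀ one_le_two
  have h42 : (4 : ℝ) ^ a.scale = 2 ^ a.scale * 2 ^ a.scale := by rw [← mul_pow]; norm_num
  have hdir : Matrix.toEuclideanCLM (𝕜 := ℝ) (a.mat : Matrix (Fin d) (Fin d) ℝ).transpose ξ a.dir =
      (4 ^ a.scale)⁻¹ * ξ a.dir := by
    rw [mat_transpose_apply, if_pos rfl]
    simp [shearOff]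
  have h3 := h2 a.dir
  rw [hdir] at h1 h3
  have h5 : |(4 ^ a.scale)⁻¹ * ξ a.dir| = |ξ a.dir| / 4 ^ a.scale := by
    rw [abs_mul, abs_inv, abs_of_pos h4, inv_mul_eq_div]
  constructor
  · rw [h5, le_div_iff₀ h4] at h1
    linarith [abs_apply_le_norm ξ a.dir]
  · refine norm_le_of_forall_abs_le fun m => ?_
    by_cases hm : m = a.dir
    · rw [h5, div_le_iff₀ h4] at h3
      rw [hm]
      linarith
    · have h6 := h2 m
      rw [mat_transpose_apply, if_neg hm] at h6
      have h7 : |shearOff a.dir (-a.shear) a.dir m * ((4 ^ a.scale)⁻¹ * ξ a.dir)| ≤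
          2 ^ a.scale * (1 / 2) := by
        rw [abs_mul]
        exact mul_le_mul (abs_shearOff_le a _ _) h3 (abs_nonneg _) (by positivity)
      have h8 : |(2 ^ a.scale)⁻¹ * ξ m| ≤ 2 ^ a.scale := by
        rw [abs_le] at *
        constructor <;> linarith
      rw [abs_mul, abs_inv, abs_of_pos (by positivity), inv_mul_le_iff₀ (by positivity)] at h8
      rwa [h42]

/-- In the sheared row the factor `4^{-j}` absorbs `|ℓ_m| ≤ 2^j`; the other rows only carry `2^{-j}`
on the diagonal. -/
theorem abs_mat_apply_le {d : ℕ} (a : ShearIndex d) (m r : Fin d) :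
    |(a.mat : Matrix (Fin d) (Fin d) ℝ) m r| ≤ (2 ^ a.scale)⁻¹ := by
  have h20 : (1 : ℝ) ≤ 2 ^ a.scale := one_le_pow₀ one_le_two
  have h42 : ((4 : ℝ) ^ a.scale)⁻¹ = (2 ^ a.scale)⁻¹ * (2 ^ a.scale)⁻¹ := by
    rw [← mul_inv, ← mul_pow]; norm_num
  have hinv : ((2 : ℝ) ^ a.scale)⁻¹ ≤ 1 := inv_le_one_of_one_le₀ h20
  have hpos : (0 : ℝ) < (2 ^ a.scale)⁻¹ := by positivity
  rw [coe_mat, Matrix.diagonal_mul, Matrix.add_apply, Matrix.one_apply, abs_mul]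
  by_cases hm : m = a.dir
  · rw [if_pos hm, h42, abs_of_pos (by positivity), mul_assoc]
    refine mul_le_of_le_one_right hpos.le ?_
    rw [inv_mul_le_iff₀ (by positivity), mul_one]
    by_cases hr : m = r
    · subst hr
      simpa [shearOff, hm] using h20
    · simpa [hr] using abs_shearOff_le a m r
  · rw [if_neg hm, abs_of_pos hpos]
    refine mul_le_of_le_one_right hpos.le ?_
    by_cases hr : m = r
    · subst hr
      simp [shearOff, hm]
    · simp [shearOff, hm, hr]

theorem norm_mat_apply_le {d : ℕ} (a : ShearIndex d) (u : E d) :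
    2 ^ a.scale * ‖euclEquiv a.mat u‖ ≤ (d : ℝ) ^ 2 * ‖u‖ := by
  have h (m : Fin d) : |euclEquiv a.mat u m| ≤ d * ((2 ^ a.scale)⁻¹ * ‖u‖) := by
    rw [euclEquiv_apply, Matrix.mulVec, dotProduct]
    refine (Finset.abs_sum_le_sum_abs _ _).trans ?_
    calc _ ≤ ∑ _r : Fin d, ((2 : ℝ) ^ a.scale)⁻¹ * ‖u‖ := by
          gcongr with r
          rw [abs_mul]
          exact mul_le_mul (abs_mat_apply_le a m r) (abs_apply_le_norm u r) (abs_nonneg _)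
            (by positivity)
      _ = _ := by simp
  have h1 := norm_le_of_forall_abs_le h
  calc 2 ^ a.scale * ‖euclEquiv a.mat u‖ ≤
        2 ^ a.scale * (d * (d * ((2 ^ a.scale)⁻¹ * ‖u‖))) := by gcongr
    _ = (2 ^ a.scale * (2 ^ a.scale)⁻¹) * ((d : ℝ) ^ 2 * ‖u‖) := by ring
    _ = _ := by rw [mul_inv_cancel₀ (by positivity), one_mul]

/-! ### Norms of dyadic dilates in the classical spaces -/

theorem abs_sub_le_of_conv_dyadicDilate_ne_zero {d : ℕ} {Φ φ : 𝓢(E d, ℂ)}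
    (hφ : IsDyadicPair Φ φ) {ν μ : ℕ} {x : E d}
    (h : conv (compDyadic ν φ : 𝓢'(E d, ℂ)) (dyadicDilate μ φ) x ≠ 0) :
    ν ≤ μ + 2 ∧ μ ≤ ν + 2 := by
  by_contra hc
  refine h (conv_eq_zero_of_fourier _ _ (fun ξ h1 => ?_) x)
  by_contra h2
  obtain ⟨h3, h4⟩ := fourier_compDyadic_ne_zero hφ ν h1
  obtain ⟨h5, h6⟩ := fourier_dyadicDilate_ne_zero hφ μ h2
  have e1 : (2 : ℝ) ^ ν ≤ 2 ^ (μ + 2) := by rw [pow_add]; linarith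
  have e2 : (2 : ℝ) ^ μ ≤ 2 ^ (ν + 2) := by rw [pow_add]; linarith
  rw [pow_le_pow_iff_right₀ one_lt_two] at e1 e2
  exact hc ⟨e1, e2⟩

theorem exists_eLpNorm_dyadic_le {d : ℕ} {Φ φ : 𝓢(E d, ℂ)} (hφ : IsDyadicPair Φ φ) (α : ℝ)
    {q : ℝ≥0∞} (hq : 0 < q) {p : ℝ} (hp : 0 < p) :
    ∃ D : ℝ≥0∞, D ≠ ∞ ∧ ∀ (ν : ℕ) (s : ℂ),
      eLpNorm (fun x : E d => lqNorm q fun μ : ℕ => ENNReal.ofReal ((2 : ℝ) ^ ((μ : ℝ) * α)) *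
        ‖conv ((s • compDyadic ν φ : 𝓢(E d, ℂ)) : 𝓢'(E d, ℂ)) (dyadicDilate μ φ) x‖ₑ)
        (ENNReal.ofReal p) volume ≤
      ENNReal.ofReal (‖s‖ * 2 ^ (ν * (α - d / p))) * D := by
  obtain ⟨N, hN⟩ := Measure.HasTemperateGrowth.exists_eLpNorm_lt_top (ENNReal.ofReal p)
    (μ := (volume : Measure (E d))) inferInstance
  -- `K = 4` because `2^ν ≤ 4 · 2^μ` for the interacting scales.
  obtain ⟨C, hC0, hC⟩ := conv_linDilate_decay φ φ N 4 (by norm_num)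
  refine ⟨ENNReal.ofReal ((5 : ℝ) ^ (q⁻¹).toReal * (2 ^ (2 * |α|) * C)) *
    eLpNorm (fun x : E d => (1 + ‖x‖) ^ (-(N : ℝ))) (ENNReal.ofReal p) volume,
    ENNReal.mul_ne_top ENNReal.ofReal_ne_top hN.ne, fun ν s => ?_⟩
  set T := Finset.Icc (ν - 2) (ν + 2)
  have hcard : (T.card : ℝ) ≤ 5 := by
    have : T.card ≤ 5 := by rw [Nat.card_Icc]; omega
    exact_mod_cast this
  have hT (μ : ℕ) : μ ∈ T ↔ ν ≤ μ + 2 ∧ μ ≤ ν + 2 := by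
    rw [Finset.mem_Icc]; omega
  refine (eLpNorm_lqNorm_le (N := N) hq hp Function.injective_id T
    (R := 2 ^ ν) (by positivity) (fun μ : ℕ => (2 : ℝ) ^ ((μ : ℝ) * α))
    (fun μ => conv ((s • compDyadic ν φ : 𝓢(E d, ℂ)) : 𝓢'(E d, ℂ)) (dyadicDilate μ φ))
    (B := 2 ^ (2 * |α|) * 2 ^ (ν * α) * ‖s‖ * C) (by positivity) ?_ ?_).trans ?_
  · intro μ x h
    rw [conv_smul] at h
    exact (hT μ).2 (abs_sub_le_of_conv_dyadicDilate_ne_zero hφ (right_ne_zero_of_mul h))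
  · intro μ hμ x
    obtain ⟨h1, h2⟩ := (hT μ).1 hμ
    have e1 : (2 : ℝ) ^ ((μ : ℝ) * α) ≤ 2 ^ (2 * |α|) * 2 ^ (ν * α) := by
      rw [← Real.rpow_add two_pos]
      refine Real.rpow_le_rpow_of_exponent_le one_le_two ?_
      have h3 : |(μ : ℝ) - ν| ≤ 2 := by
        rw [abs_le]
        have h1' : (ν : ℝ) ≤ μ + 2 := by exact_mod_cast h1
        have h2' : (μ : ℝ) ≤ ν + 2 := by exact_mod_cast h2
        constructor <;> linarith
      have h4 : ((μ : ℝ) - ν) * α ≤ 2 * |α| := by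
        refine (le_abs_self _).trans ?_
        rw [abs_mul]
        gcongr
      linarith
    have e2 : ‖conv (compDyadic ν φ : 𝓢'(E d, ℂ)) (dyadicDilate μ φ) x‖ ≤
        C * (1 + ‖(2 : ℝ) ^ ν • x‖) ^ (-(N : ℝ)) := by
      rw [dyadicDilate_eq_linDilate]
      refine hC (dyadicScale d μ) (2 ^ ν) (2 ^ ν) (by positivity) (by positivity) ?_ ?_ _
        (compDyadic_apply ν φ) x
      · linarith [pow_pos (two_pos (α := ℝ)) ν]
      · intro u
        have h5 : (2 : ℝ) ^ ν ≤ 4 * 2 ^ μ := by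
          calc (2 : ℝ) ^ ν ≤ 2 ^ (μ + 2) := pow_le_pow_right₀ one_le_two h1
            _ = _ := by rw [pow_add]; ring
        rw [dyadicScale_apply, norm_smul, norm_inv, norm_pow, Real.norm_ofNat, ← mul_assoc,
          ← div_eq_mul_inv]
        gcongr
        rw [div_le_iff₀ (by positivity)]
        exact h5
    rw [conv_smul, norm_mul]
    calc _ ≤ (2 ^ (2 * |α|) * 2 ^ (ν * α)) *
          (‖s‖ * (C * (1 + ‖(2 : ℝ) ^ ν • x‖) ^ (-(N : ℝ)))) := by gcongr
      _ = _ := by ring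
  · rw [← mul_assoc (ENNReal.ofReal _) (ENNReal.ofReal _), ← ENNReal.ofReal_mul (by positivity)]
    gcongr ENNReal.ofReal ?_ * _
    have e3 : ((2 : ℝ) ^ ν) ^ (-(d / p)) = 2 ^ (-(ν * (d / p))) := by
      rw [← Real.rpow_natCast, ← Real.rpow_mul two_pos.le, mul_neg]
    have e4 : (2 : ℝ) ^ (ν * (α - d / p)) = 2 ^ (ν * α) * 2 ^ (-(ν * (d / p))) := by
      rw [← Real.rpow_add two_pos]; ring_nf
    rw [e3, e4]
    calc _ ≤ (5 : ℝ) ^ (q⁻¹).toReal * (2 ^ (2 * |α|) * 2 ^ (ν * α) * ‖s‖ * C) *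
          2 ^ (-(ν * (d / p))) := by gcongr
      _ = _ := by ring

/-- Only the term `μ = ν` is kept; it is exactly a rescaled copy of `φ * φ`. -/
theorem le_eLpNorm_dyadic {d : ℕ} (φ : 𝓢(E d, ℂ)) (α : ℝ)
    {q : ℝ≥0∞} (hq : 0 < q) {p : ℝ} (hp : 0 < p) (ν : ℕ) (s : ℂ) :
    ENNReal.ofReal (‖s‖ * 2 ^ (ν * (α - d / p))) *
        eLpNorm (conv (φ : 𝓢'(E d, ℂ)) φ) (ENNReal.ofReal p) volume ≤
      eLpNorm (fun x : E d => lqNorm q fun μ : ℕ => ENNReal.ofReal ((2 : ℝ) ^ ((μ : ℝ) * α)) *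
        ‖conv ((s • compDyadic ν φ : 𝓢(E d, ℂ)) : 𝓢'(E d, ℂ)) (dyadicDilate μ φ) x‖ₑ)
        (ENNReal.ofReal p) volume := by
  have e3 : ((2 : ℝ) ^ ν) ^ (-(d / p)) = 2 ^ (-(ν * (d / p))) := by
    rw [← Real.rpow_natCast, ← Real.rpow_mul two_pos.le, mul_neg]
  have e4 : (2 : ℝ) ^ (ν * (α - d / p)) = 2 ^ (ν * α) * 2 ^ (-(ν * (d / p))) := by
    rw [← Real.rpow_add two_pos]; ring_nf
  have h1 := eLpNorm_comp_smul_euclidean (conv (φ : 𝓢'(E d, ℂ)) φ) (R := 2 ^ ν)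
    (by positivity) hp
  calc _ = ENNReal.ofReal (2 ^ (ν * α) * ‖s‖) *
        eLpNorm (fun x => conv (φ : 𝓢'(E d, ℂ)) φ ((2 : ℝ) ^ ν • x)) (ENNReal.ofReal p) volume := by
        rw [h1, e3, e4, ← mul_assoc (ENNReal.ofReal _) (ENNReal.ofReal _),
          ← ENNReal.ofReal_mul (by positivity)]
        ring_nf
    _ = eLpNorm ((((2 ^ (ν * α) * ‖s‖ : ℝ) : ℂ)) •
          fun x => conv (φ : 𝓢'(E d, ℂ)) φ ((2 : ℝ) ^ ν • x)) (ENNReal.ofReal p) volume := by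
        rw [eLpNorm_const_smul, ← ofReal_norm, Complex.norm_real,
          Real.norm_of_nonneg (by positivity)]
    _ ≤ _ := by
        refine eLpNorm_mono_enorm fun x => ?_
        rw [enorm_eq_self]
        refine le_trans (le_of_eq ?_) (le_lqNorm hq _ ν)
        rw [conv_smul, conv_compDyadic_dyadicDilate, Pi.smul_apply, smul_eq_mul, enorm_mul,
          enorm_mul, ← mul_assoc, ← ofReal_norm, Complex.norm_real,
          Real.norm_of_nonneg (by positivity), ENNReal.ofReal_mul (by positivity), ofReal_norm]

/-- The Fourier transform is the square of that of `φ`, which does not vanish at a unit vector. -/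
theorem conv_self_ne_zero {d : ℕ} (hd : 0 < d) {Φ φ : 𝓢(E d, ℂ)} (hφ : IsDyadicPair Φ φ) :
    SchwartzMap.convolution (ContinuousLinearMap.mul ℂ ℂ) φ φ ≠ 0 := by
  intro h0
  obtain ⟨c, hc, h⟩ := hφ.lower_phi
  have h1 : ‖(EuclideanSpace.single (⟨0, hd⟩ : Fin d) (1 : ℝ) : E d)‖ = 1 := by simp
  have h2 := h _ (by rw [h1]; norm_num) (by rw [h1]; norm_num)
  have h3 := fourier_convolution_mul φ φ (EuclideanSpace.single (⟨0, hd⟩ : Fin d) (1 : ℝ))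
  rw [h0, FourierTransform.fourier_zero, _root_.zero_apply, zero_eq_mul_self] at h3
  rw [h3, norm_zero] at h2
  linarith

theorem eLpNorm_conv_lt_top {d : ℕ} (f g : 𝓢(E d, ℂ)) (p : ℝ≥0∞) :
    eLpNorm (conv (f : 𝓢'(E d, ℂ)) g) p volume < ∞ := by
  rw [conv_eq_convolution]
  exact (SchwartzMap.convolution (ContinuousLinearMap.mul ℂ ℂ) f g).eLpNorm_lt_top p volume

theorem eLpNorm_conv_self_ne_zero {d : ℕ} (hd : 0 < d) {Φ φ : 𝓢(E d, ℂ)}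
    (hφ : IsDyadicPair Φ φ) {p : ℝ} (hp : 0 < p) :
    eLpNorm (conv (φ : 𝓢'(E d, ℂ)) φ) (ENNReal.ofReal p) volume ≠ 0 := by
  rw [conv_eq_convolution]
  intro h
  rw [eLpNorm_eq_zero_iff (SchwartzMap.continuous _).aestronglyMeasurable (by simpa using hp),
    (SchwartzMap.continuous _).ae_eq_iff_eq volume continuous_zero] at h
  exact conv_self_ne_zero hd hφ (DFunLike.coe_injective h)

/-! ### Norms of dyadic dilates in the shear anisotropic spaces -/

theorem ShearIndex.encode_injective {d : ℕ} : Function.Injective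
    (fun a : ShearIndex d => (⟨a.dir, a.scale, a.shear⟩ :
      Σ i : Fin d, Σ _ : ℕ, ({m : Fin d // m ≠ i} → ℤ))) := by
  rintro ⟨i, j, l, h⟩ ⟨i', j', l', h'⟩ heq
  simp only [Sigma.mk.injEq] at heq
  obtain ⟨rfl, heq⟩ := heq
  simp only [heq_eq_eq, Sigma.mk.injEq] at heq
  obtain ⟨rfl, rfl⟩ := heq
  rfl

/-- The indices whose frequency support may meet the annulus `|ξ| ∼ 2^ν`. -/
noncomputable def shearIndices (d ν : ℕ) : Finset (Σ i : Fin d, Σ _ : ℕ, ({m : Fin d // m ≠ i} → ℤ)) :=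
  Finset.univ.sigma fun _ => (Finset.Icc ((ν - (d + 1)) / 2) ((ν + 5) / 2)).sigma fun j =>
    Fintype.piFinset fun _ => Finset.Icc (-2 ^ j) (2 ^ j)

theorem card_shearIndices_le {d : ℕ} (hd : 0 < d) (ν : ℕ) :
    ((shearIndices d ν).card : ℝ) ≤
      (d * (d + 8) * (3 * 2 ^ (5 / 2 : ℝ)) ^ (d - 1)) * 2 ^ (ν * (((d : ℝ) - 1) / 2)) := by
  have hinner (i : Fin d) (j : ℕ) (hj : j ∈ Finset.Icc ((ν - (d + 1)) / 2) ((ν + 5) / 2)) :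
      ((Fintype.piFinset fun _ : {m : Fin d // m ≠ i} =>
        Finset.Icc (-2 ^ j : ℤ) (2 ^ j)).card : ℝ) ≤ (3 * 2 ^ (((ν : ℝ) + 5) / 2)) ^ (d - 1) := by
    rw [Fintype.card_piFinset, Finset.prod_const, Int.card_Icc, Finset.card_univ]
    have h1 : Fintype.card {m : Fin d // m ≠ i} = d - 1 := by simp
    rw [h1]
    push_cast
    -- Each coordinate has `2 · 2^j + 1 ≤ 3 · 2^j` admissible shears.
    have h2 : (2 : ℤ) ^ j + 1 - -2 ^ j = ((2 * 2 ^ j + 1 : ℕ) : ℤ) := by push_cast; ring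
    rw [h2, Int.toNat_natCast]
    have h3 : (2 : ℝ) ^ j ≤ 2 ^ (((ν : ℝ) + 5) / 2) := by
      rw [← Real.rpow_natCast]
      refine Real.rpow_le_rpow_of_exponent_le one_le_two ?_
      have : 2 * j ≤ ν + 5 := by
        rw [Finset.mem_Icc] at hj
        omega
      have : (2 : ℝ) * j ≤ ν + 5 := by exact_mod_cast this
      linarith
    have h4 : (1 : ℝ) ≤ 2 ^ j := one_le_pow₀ one_le_two
    refine pow_le_pow_left₀ (by positivity) ?_ _
    push_cast
    linarith
  have hJ : ((Finset.Icc ((ν - (d + 1)) / 2) ((ν + 5) / 2)).card : ℝ) ≤ d + 8 := by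
    have : (Finset.Icc ((ν - (d + 1)) / 2) ((ν + 5) / 2)).card ≤ d + 8 := by
      rw [Nat.card_Icc]; omega
    exact_mod_cast this
  rw [shearIndices, Finset.card_sigma]
  push_cast [Finset.card_sigma]
  calc _ ≤ ∑ _i : Fin d, ∑ _j ∈ Finset.Icc ((ν - (d + 1)) / 2) ((ν + 5) / 2),
        ((3 : ℝ) * 2 ^ (((ν : ℝ) + 5) / 2)) ^ (d - 1) :=
        Finset.sum_le_sum fun i _ => Finset.sum_le_sum fun j hj => hinner i j hj
    _ = d * ((Finset.Icc ((ν - (d + 1)) / 2) ((ν + 5) / 2)).card *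
          ((3 : ℝ) * 2 ^ (((ν : ℝ) + 5) / 2)) ^ (d - 1)) := by simp
    _ ≤ d * ((d + 8) * ((3 : ℝ) * 2 ^ (((ν : ℝ) + 5) / 2)) ^ (d - 1)) := by gcongr
    _ = _ := by
        have e1 : (2 : ℝ) ^ (((ν : ℝ) + 5) / 2) = 2 ^ (5 / 2 : ℝ) * 2 ^ ((ν : ℝ) / 2) := by
          rw [← Real.rpow_add two_pos]; ring_nf
        have e2 : (2 : ℝ) ^ (ν * (((d : ℝ) - 1) / 2)) = (2 ^ ((ν : ℝ) / 2)) ^ (d - 1) := by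
          rw [← Real.rpow_natCast, ← Real.rpow_mul two_pos.le, Nat.cast_sub hd, Nat.cast_one]
          ring_nf
        rw [e1, e2, ← mul_assoc, ← mul_assoc, mul_pow]
        ring

/-- Comparing the annuli gives `4^j ≤ 16 · 2 · 2^ν = 2^{ν+5}` and `2^ν ≤ 2d · 4^j ≤ 2^{2j+d+1}`. -/
theorem mem_shearIndices_of_conv_ne_zero {d : ℕ} {Φ φ : 𝓢(E d, ℂ)} (hφ : IsDyadicPair Φ φ)
    (G : ShearletGenerators d) {ν : ℕ} {a : ShearIndex d} {x : E d}
    (h : conv (compDyadic ν φ : 𝓢'(E d, ℂ)) (dilate a.mat (tilde (G.psi a.dir))) x ≠ 0) :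
    (⟨a.dir, a.scale, a.shear⟩ : Σ i : Fin d, Σ _ : ℕ, ({m : Fin d // m ≠ i} → ℤ)) ∈
      shearIndices d ν := by
  have hs : 2 * a.scale ≤ ν + 5 ∧ ν ≤ 2 * a.scale + d + 1 := by
    by_contra hc
    refine h (conv_eq_zero_of_fourier _ _ (fun ξ h1 => ?_) x)
    by_contra h2
    obtain ⟨h3, h4⟩ := fourier_compDyadic_ne_zero hφ ν h1
    obtain ⟨h5, h6⟩ := fourier_shearlet_ne_zero G a h2
    have h4' : (4 : ℝ) ^ a.scale = 2 ^ (2 * a.scale) := by rw [pow_mul]; norm_num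
    have hd : (d : ℝ) ≤ 2 ^ d := by exact_mod_cast Nat.lt_two_pow_self.le
    rw [h4'] at h5 h6
    have e1 : (2 : ℝ) ^ (2 * a.scale) ≤ 2 ^ (ν + 5) := by rw [pow_add 2 ν]; linarith
    have e2 : (2 : ℝ) ^ ν ≤ 2 ^ (2 * a.scale + d + 1) := by
      calc (2 : ℝ) ^ ν ≤ 2 * (d * 2 ^ (2 * a.scale)) := by linarith
        _ ≤ 2 * (2 ^ d * 2 ^ (2 * a.scale)) := by gcongr
        _ = _ := by ring
    rw [pow_le_pow_iff_right₀ one_lt_two] at e1 e2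
    exact hc ⟨e1, e2⟩
  simp only [shearIndices, Finset.mem_sigma, Finset.mem_univ, true_and, Finset.mem_Icc,
    Fintype.mem_piFinset]
  exact ⟨⟨by omega, by omega⟩, fun m => abs_le.1 (a.bound m)⟩

theorem exists_eLpNorm_shear_le {d : ℕ} (hd : 0 < d) {Φ φ : 𝓢(E d, ℂ)} (hφ : IsDyadicPair Φ φ)
    (G : ShearletGenerators d) (α : ℝ) {q : ℝ≥0∞} (hq : 0 < q) {p : ℝ} (hp : 0 < p) :
    ∃ D : ℝ≥0∞, D ≠ ∞ ∧ ∀ (ν : ℕ) (s : ℂ),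
      eLpNorm (fun x : E d => lqNorm q fun a : ShearIndex d =>
        ENNReal.ofReal (cubeVol d a.scale ^ (-α)) *
        ‖conv ((s • compDyadic ν φ : 𝓢(E d, ℂ)) : 𝓢'(E d, ℂ))
          (dilate a.mat (tilde (G.psi a.dir))) x‖ₑ) (ENNReal.ofReal p) volume ≤
      ENNReal.ofReal (‖s‖ * 2 ^ (ν * (((d : ℝ) - 1) / 2 * (q⁻¹).toReal + (d + 1) * α / 2 -
        d / (2 * p)))) * D := by
  obtain ⟨N, hN⟩ := Measure.HasTemperateGrowth.exists_eLpNorm_lt_top (ENNReal.ofReal p)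
    (μ := (volume : Measure (E d))) inferInstance
  -- The power of two compares `2^{ν/2}` with `2^j`; `d ^ 2` is the constant of `norm_mat_apply_le`.
  set K : ℝ := 2 ^ (d + 2) * d ^ 2 with hKdef
  have hd' : (1 : ℝ) ≤ d := by exact_mod_cast hd
  have hK : 1 ≤ K := one_le_mul_of_one_le_of_one_le (one_le_pow₀ one_le_two) (one_le_pow₀ hd')
  choose c hc0 hc using fun i => conv_linDilate_decay φ (tilde (G.psi i)) N K hK
  set C := ∑ i, c i with hCdef
  have hC0 : 0 ≤ C := Finset.sum_nonneg fun i _ => hc0 i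
  have hcC (i : Fin d) : c i ≤ C := Finset.single_le_sum (fun i _ => hc0 i) (Finset.mem_univ i)
  set A : ℝ := d * (d + 8) * (3 * 2 ^ (5 / 2 : ℝ)) ^ (d - 1) with hAdef
  -- The price of replacing `j` by `ν/2` in the weight, as `|j - ν/2| ≤ d + 5`.
  set W : ℝ := 2 ^ ((d + 1) * |α| * (d + 5)) with hWdef
  refine ⟨ENNReal.ofReal (A ^ (q⁻¹).toReal * (W * C)) *
    eLpNorm (fun x : E d => (1 + ‖x‖) ^ (-(N : ℝ))) (ENNReal.ofReal p) volume,
    ENNReal.mul_ne_top ENNReal.ofReal_ne_top hN.ne, fun ν s => ?_⟩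
  refine (eLpNorm_lqNorm_le (N := N) hq hp ShearIndex.encode_injective (shearIndices d ν)
    (R := 2 ^ ((ν : ℝ) / 2)) (by positivity) (fun a : ShearIndex d => cubeVol d a.scale ^ (-α))
    (fun a => conv ((s • compDyadic ν φ : 𝓢(E d, ℂ)) : 𝓢'(E d, ℂ))
      (dilate a.mat (tilde (G.psi a.dir))))
    (B := W * 2 ^ (ν * ((d + 1) * α / 2)) * ‖s‖ * C) (by positivity) ?_ ?_).trans ?_
  · intro a x h
    rw [conv_smul] at h
    exact mem_shearIndices_of_conv_ne_zero hφ G (right_ne_zero_of_mul h)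
  · intro a ha x
    simp only [shearIndices, Finset.mem_sigma, Finset.mem_univ, true_and, Finset.mem_Icc] at ha
    have h1 : 2 * (a.scale : ℝ) ≤ ν + 5 := by
      have : 2 * a.scale ≤ ν + 5 := by omega
      exact_mod_cast this
    -- Here `d + 2` rather than `d + 1`: the lower end of `shearIndices` is rounded down.
    have h2 : (ν : ℝ) ≤ 2 * a.scale + d + 2 := by
      have : ν ≤ 2 * a.scale + d + 2 := by omega
      exact_mod_cast this
    have e1 : cubeVol d a.scale ^ (-α) ≤ W * 2 ^ (ν * ((d + 1) * α / 2)) := by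
      rw [cubeVol, Real.inv_rpow (by positivity), Real.rpow_neg (by positivity), inv_inv,
        ← Real.rpow_natCast, ← Real.rpow_mul two_pos.le, hWdef, ← Real.rpow_add two_pos]
      refine Real.rpow_le_rpow_of_exponent_le one_le_two ?_
      push_cast
      have h3 : |(a.scale : ℝ) - ν / 2| ≤ d + 5 := by
        rw [abs_le]
        constructor <;> linarith
      have h4 : ((a.scale : ℝ) - ν / 2) * α ≤ (d + 5) * |α| := by
        refine (le_abs_self _).trans ?_
        rw [abs_mul]
        gcongr
      have h5 := mul_le_mul_of_nonneg_left h4 (by positivity : (0 : ℝ) ≤ d + 1)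
      linarith
    have e2 : ‖conv (compDyadic ν φ : 𝓢'(E d, ℂ)) (dilate a.mat (tilde (G.psi a.dir))) x‖ ≤
        C * (1 + ‖(2 : ℝ) ^ ((ν : ℝ) / 2) • x‖) ^ (-(N : ℝ)) := by
      rw [dilate_eq_linDilate]
      -- The decay scale is `2^{ν/2}`, that of the kernel's longest directions, although `φ(2^ν ·)`
      -- is concentrated at the finer scale `2^{-ν}`.
      refine (hc a.dir (euclEquiv a.mat) (2 ^ ((ν : ℝ) / 2)) (2 ^ ν) (by positivity)
        (by positivity) ?_ ?_ _ (compDyadic_apply ν φ) x).trans ?_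
      · rw [← Real.rpow_natCast 2 ν]
        refine le_trans ?_ (le_mul_of_one_le_left (by positivity) hK)
        refine Real.rpow_le_rpow_of_exponent_le one_le_two ?_
        linarith [(Nat.cast_nonneg ν : (0 : ℝ) ≤ ν)]
      · intro u
        have h6 : (2 : ℝ) ^ ((ν : ℝ) / 2) ≤ 2 ^ (d + 2) * 2 ^ a.scale := by
          rw [← pow_add, ← Real.rpow_natCast]
          refine Real.rpow_le_rpow_of_exponent_le one_le_two ?_
          push_cast
          linarith
        calc _ ≤ 2 ^ (d + 2) * 2 ^ a.scale * ‖euclEquiv a.mat u‖ := by gcongr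
          _ = 2 ^ (d + 2) * (2 ^ a.scale * ‖euclEquiv a.mat u‖) := by ring
          _ ≤ 2 ^ (d + 2) * ((d : ℝ) ^ 2 * ‖u‖) :=
              mul_le_mul_of_nonneg_left (norm_mat_apply_le a u) (by positivity)
          _ = _ := by rw [hKdef]; ring
      · gcongr
        exact hcC _
    rw [conv_smul, norm_mul]
    calc _ ≤ (W * 2 ^ (ν * ((d + 1) * α / 2))) *
          (‖s‖ * (C * (1 + ‖(2 : ℝ) ^ ((ν : ℝ) / 2) • x‖) ^ (-(N : ℝ)))) := by gcongr
      _ = _ := by ring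
  · rw [← mul_assoc (ENNReal.ofReal _) (ENNReal.ofReal _), ← ENNReal.ofReal_mul (by positivity)]
    gcongr ENNReal.ofReal ?_ * _
    have e3 : ((2 : ℝ) ^ ((ν : ℝ) / 2)) ^ (-(d / p)) = 2 ^ (-(ν * (d / (2 * p)))) := by
      rw [← Real.rpow_mul two_pos.le]
      congr 1
      field_simp
    have e4 : (2 : ℝ) ^ (ν * (((d : ℝ) - 1) / 2 * (q⁻¹).toReal + (d + 1) * α / 2 -
        d / (2 * p))) = 2 ^ (ν * (((d : ℝ) - 1) / 2) * (q⁻¹).toReal) *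
          2 ^ (ν * ((d + 1) * α / 2)) * 2 ^ (-(ν * (d / (2 * p)))) := by
      rw [← Real.rpow_add two_pos, ← Real.rpow_add two_pos]; ring_nf
    have e5 : ((shearIndices d ν).card : ℝ) ^ (q⁻¹).toReal ≤
        A ^ (q⁻¹).toReal * 2 ^ (ν * (((d : ℝ) - 1) / 2) * (q⁻¹).toReal) := by
      rw [Real.rpow_mul two_pos.le, ← Real.mul_rpow (by positivity) (by positivity)]
      exact Real.rpow_le_rpow (by positivity) (card_shearIndices_le hd ν) ENNReal.toReal_nonneg
    rw [e3, e4]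
    calc _ ≤ (A ^ (q⁻¹).toReal * 2 ^ (ν * (((d : ℝ) - 1) / 2) * (q⁻¹).toReal)) *
          (W * 2 ^ (ν * ((d + 1) * α / 2)) * ‖s‖ * C) * 2 ^ (-(ν * (d / (2 * p)))) := by gcongr
      _ = _ := by ring

/-! ### The low frequency parts -/

theorem conv_compDyadic_eq_zero_of_low_frequency {d : ℕ} {Φ φ : 𝓢(E d, ℂ)}
    (hφ : IsDyadicPair Φ φ) {g : 𝓢(E d, ℂ)} {r : ℝ}
    (hg : ∀ ξ, (𝓕 g : 𝓢(E d, ℂ)) ξ ≠ 0 → ‖ξ‖ ≤ r) {ν : ℕ} (hν : 2 * r < 2 ^ ν) (s : ℂ) :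
    conv ((s • compDyadic ν φ : 𝓢(E d, ℂ)) : 𝓢'(E d, ℂ)) g = 0 := by
  ext x
  rw [conv_smul, conv_eq_zero_of_fourier _ _ (fun ξ h1 => ?_) x, mul_zero]
  · rfl
  · by_contra h2
    linarith [hg ξ h2, (fourier_compDyadic_ne_zero hφ ν h1).1]

end ShearTL

/-! ### Choice of the multiples and conclusion. -/

open ShearTL in
theorem mainTheorem12 (d : ℕ) (hd : 2 ≤ d) (Φ φ : 𝓢(ShearTL.E d, ℂ))
    (hφ : ShearTL.IsDyadicPair Φ φ) (G : ShearTL.ShearletGenerators d)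
    (α₁ α₂ : ℝ) (q₁ q₂ : ℝ≥0∞) (hq₁ : 0 < q₁) (hq₂ : 0 < q₂)
    (p₁ p₂ : ℝ) (hp₁ : 0 < p₁) (hp₂ : 0 < p₂)
    (h : ((d : ℝ) - 1) * (q₂⁻¹).toReal + ((d : ℝ) + 1) * α₂ + 2 * d / p₁ < 2 * α₁ + d / p₂) :
    ∃ f : ℕ → 𝓢(ShearTL.E d, ℂ),
      (∀ ν, ∃ s : ℂ, f ν = s • ShearTL.dyadicWavelet φ ν) ∧
      (∃ c C : ℝ≥0, 0 < c ∧ ∀ ν,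
        (c : ℝ≥0∞) ≤ ShearTL.normF Φ φ α₁ q₁ p₁ (f ν : 𝓢'(ShearTL.E d, ℂ)) ∧
        ShearTL.normF Φ φ α₁ q₁ p₁ (f ν : 𝓢'(ShearTL.E d, ℂ)) ≤ C) ∧
      (∀ ν, ShearTL.normFAB G α₂ q₂ p₂ (f ν : 𝓢'(ShearTL.E d, ℂ)) < ∞) ∧
      Tendsto (fun ν => ShearTL.normFAB G α₂ q₂ p₂ (f ν : 𝓢'(ShearTL.E d, ℂ))) atTop (𝓝 0) := by
  have hd0 : 0 < d := by omega
  set s : ℕ → ℂ := fun ν => (((2 : ℝ) ^ (ν * (d / p₁ - α₁)) : ℝ) : ℂ) with hs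
  have hsn (ν : ℕ) : ‖s ν‖ = 2 ^ (ν * (d / p₁ - α₁)) := by
    rw [hs, Complex.norm_real, Real.norm_of_nonneg (by positivity)]
  have hs1 (ν : ℕ) : ‖s ν‖ * 2 ^ (ν * (α₁ - d / p₁)) = 1 := by
    rw [hsn, ← Real.rpow_add two_pos]; ring_nf; simp
  obtain ⟨D₁, hD₁, hF⟩ := exists_eLpNorm_dyadic_le hφ α₁ hq₁ hp₁
  obtain ⟨D₂, hD₂, hAB⟩ := exists_eLpNorm_shear_le hd0 hφ G α₂ hq₂ hp₂
  -- Half the difference of the two sides of `h`.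
  set δ : ℝ := ((d : ℝ) - 1) / 2 * (q₂⁻¹).toReal + (d + 1) * α₂ / 2 - d / (2 * p₂) +
    (d / p₁ - α₁) with hδdef
  have hδ : δ < 0 := by
    have e1 : (d : ℝ) / (2 * p₂) = d / p₂ / 2 := by rw [mul_comm, div_div]
    have e2 : 2 * (d : ℝ) / p₁ = 2 * (d / p₁) := mul_div_assoc _ _ _
    rw [hδdef, e1]
    rw [e2] at h
    linarith
  have hs2 (ν : ℕ) : ‖s ν‖ * 2 ^ (ν * (((d : ℝ) - 1) / 2 * (q₂⁻¹).toReal + (d + 1) * α₂ / 2 -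
      d / (2 * p₂))) = (2 ^ δ) ^ ν := by
    rw [hsn, ← Real.rpow_add two_pos, ← Real.rpow_natCast, ← Real.rpow_mul two_pos.le]
    congr 1
    rw [hδdef]
    ring
  refine ⟨fun ν => s ν • compDyadic ν φ, fun ν => ?_, ?_, fun ν => ?_, ?_⟩
  · refine ⟨s ν * (((2 : ℝ) ^ ((d : ℝ) * (ν : ℝ) / 2) : ℝ) : ℂ)⁻¹, ?_⟩
    rw [dyadicWavelet, smul_smul, mul_assoc, inv_mul_cancel₀, mul_one]
    exact Complex.ofReal_ne_zero.2 (by positivity)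
  · set L : ℕ → ℝ≥0∞ := fun ν => eLpNorm (conv ((s ν • compDyadic ν φ : 𝓢(E d, ℂ)) : 𝓢'(E d, ℂ)) Φ)
      (ENNReal.ofReal p₁) volume with hL
    -- The low-frequency term vanishes once `2^ν > 4`; the three remaining values are finite and
    -- summed into the constant.
    have hLle (ν : ℕ) : L ν ≤ ∑ μ ∈ Finset.range 3, L μ := by
      by_cases hν : ν < 3
      · exact Finset.single_le_sum (fun _ _ => zero_le) (Finset.mem_range.2 hν)
      · have : (2 : ℝ) ^ 3 ≤ 2 ^ ν := pow_le_pow_right₀ one_le_two (not_lt.1 hν)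
        rw [hL]
        simp only
        rw [conv_compDyadic_eq_zero_of_low_frequency hφ (r := 2) (fun ξ h0 => hφ.supp_Phi h0)
          (by linarith), eLpNorm_zero]
        exact zero_le
    have hLtop : ∑ μ ∈ Finset.range 3, L μ ≠ ∞ :=
      ENNReal.sum_ne_top.2 fun μ _ => (eLpNorm_conv_lt_top _ _ _).ne
    have hctop := (eLpNorm_conv_lt_top φ φ (ENNReal.ofReal p₁)).ne
    refine ⟨(eLpNorm (conv (φ : 𝓢'(E d, ℂ)) φ) (ENNReal.ofReal p₁) volume).toNNReal,
      (∑ μ ∈ Finset.range 3, L μ + D₁).toNNReal,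
      ENNReal.toNNReal_pos (eLpNorm_conv_self_ne_zero hd0 hφ hp₁) hctop, fun ν => ⟨?_, ?_⟩⟩
    · rw [ENNReal.coe_toNNReal hctop]
      have := le_eLpNorm_dyadic φ α₁ hq₁ hp₁ ν (s ν)
      rw [hs1, ENNReal.ofReal_one, one_mul] at this
      exact this.trans le_add_self
    · rw [ENNReal.coe_toNNReal (ENNReal.add_ne_top.2 ⟨hLtop, hD₁⟩)]
      refine add_le_add (hLle ν) ((hF ν (s ν)).trans_eq ?_)
      rw [hs1, ENNReal.ofReal_one, one_mul]
  · refine ENNReal.add_lt_top.2 ⟨eLpNorm_conv_lt_top _ _ _, (hAB ν (s ν)).trans_lt ?_⟩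
    exact ENNReal.mul_lt_top ENNReal.ofReal_lt_top hD₂.lt_top
  · have hgeom : Tendsto (fun ν : ℕ => ENNReal.ofReal ((2 ^ δ) ^ ν) * D₂) atTop (𝓝 0) := by
      have h1 : Tendsto (fun ν : ℕ => ((2 : ℝ) ^ δ) ^ ν) atTop (𝓝 0) :=
        tendsto_pow_atTop_nhds_zero_of_lt_one (by positivity)
          (Real.rpow_lt_one_of_one_lt_of_neg one_lt_two hδ)
      have h2 := ENNReal.Tendsto.mul_const (b := D₂) (ENNReal.tendsto_ofReal h1) (Or.inr hD₂)
      simpa using h2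
    refine tendsto_of_tendsto_of_tendsto_of_le_of_le' tendsto_const_nhds hgeom
      (Eventually.of_forall fun _ => zero_le) ?_
    -- The Fourier support of `Ψ` lies in `|ξ| ≤ d/4`, so for `ν ≥ d` it misses the annulus of `f
    -- ν`.
    filter_upwards [eventually_ge_atTop d] with ν hν
    have h0 : (2 : ℝ) * (d * (1 / 4)) < 2 ^ ν := by
      have h1 : (d : ℝ) < 2 ^ d := by exact_mod_cast Nat.lt_two_pow_self
      have h2 : (2 : ℝ) ^ d ≤ 2 ^ ν := pow_le_pow_right₀ one_le_two hν
      have h3 : (0 : ℝ) ≤ d := Nat.cast_nonneg d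
      linarith
    rw [normFAB, conv_compDyadic_eq_zero_of_low_frequency hφ
      (fun ξ hξ => norm_le_of_forall_abs_le (G.supp_Psi hξ)) h0, eLpNorm_zero, zero_add]
    refine (hAB ν (s ν)).trans_eq ?_
    rw [hs2]
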